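/- Let $k$ be an algebraically closed field of characteristic $p>0$, and let $\mathcal G$ be a finite group scheme over $k$, with coordinate ring $k[\mathcal G]$ (a finite-dimensional commutative Hopf algebra) and group algebra $k\mathcal G=k[\mathcal G]^*$ (the dual Hopf algebra). A closed subgroup scheme $\mathcal E\subseteq\mathcal G$ is called elementary abelian if its group algebra $k\mathcal E\subseteq k\mathcal G$ is isomorphic, as an algebra, to a truncated polynomial ring $k[x_1,\dots,x_n]/(x_1^p,\dots,x_n^p)$ for some $n\ge 0$. Its complexity $\mathrm{cx}_{\mathcal E}(k)$ is the polynomial rate of growth of a minimal projective resolution $P_\bullet$ of the trivial $k\mathcal E$-module $k$, i.e. the least $c\ge 0$ such that $\dim_k P_n\le C\,n^{c-1}$ for some constant $C$ and all $n\ge 1$. For $\ell\ge 0$ let $\mathfrak C(\ell,\mathcal G)$ be the set of elementary abelian subgroup schemes $\mathcal E\subseteq\mathcal G$ with $\mathrm{cx}_{\mathcal E}(k)=\ell$. For $d\ge 0$ let $\mathrm{Gr}_d(k\mathcal G)$ be the Grassmann functor, which assigns to a commutative $k$-algebra $R$ the set of $R$-direct summands of rank $d$ of $k\mathcal G\otimes_k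 R$, and let $$\mathrm{Sub}_d(k\mathcal G)(R)=\{V\in \mathrm{Gr}_d(k\mathcal G)(R)\;:\; V\cdot V\subseteq V,\ \Delta(V)\subseteq V\otimes_R V\}.$$ (a) For every $d$, $\mathrm{Sub}_d(k\mathcal G)$ is a closed subfunctor of $\mathrm{Gr}_d(k\mathcal G)$: it is stable under base change, and for every commutative $k$-algebra $B$ and every $W\in\mathrm{Gr}_d(k\mathcal G)(B)$ there is an ideal $I\subseteq B$ such that, for every $k$-algebra homomorphism $\psi:B\to R$, the base change of $W$ along $\psi$ lies in $\mathrm{Sub}_d(k\mathcal G)(R)$ if and only if $\psi(I)=0$. (b) For every $\ell\ge 0$, $\mathfrak C(\ell,\mathcal G)$ is a projective variety (possibly empty or reducible). More precisely, every $\mathcal E\in\mathfrak C(\ell,\mathcal G)$ satisfies $\dim_k k\mathcal E=p^\ell$, the map $\mathcal E\mapsto k\mathcal E$ from $\mathfrak C(\ell,\mathcal G)$ to the Grassmannian of $p^\ell$-dimensional subspaces of $k\mathcal G$ is injective, and its image is a closed subset of this Grassmannian, that is, its image under the Plücker embedding is Zariski closed in $\mathbb P(\bigwedge^{p^\ell}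 k\mathcal G)$. -/

import Mathlib

open CategoryTheory TensorProduct LinearAlgebra.Projectivization

universe u v

/-! ### Finite group schemes, their group algebras and their closed subgroups

A finite group scheme `G` over `k` is represented by its coordinate ring, a finite-dimensional
commutative Hopf algebra `A = k[G]`. -/

/-- The group algebra `kG = k[G]^*`: the linear dual of the coordinate ring `A = k[G]`, with the
convolution product `(f * g)(a) = ∑ f(a₁) g(a₂)` and the counit of `A` as its identity. -/
abbrev GroupAlg (k A : Type u) [Field k] [CommRing A] [HopfAlgebra k A] : Type u :=
  WithConv (A →ₗ[k] k)

namespace GroupAlg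

variable (k A : Type u) [Field k] [CommRing A] [HopfAlgebra k A]

instance instFinite [Module.Finite k A] : Module.Finite k (GroupAlg k A) :=
  Module.Finite.equiv (WithConv.linearEquiv k (A →ₗ[k] k)).symm

/-- The augmentation `kG → k`, which is evaluation of functionals at `1 ∈ k[G]`. -/
noncomputable def augmentation : GroupAlg k A →ₐ[k] k :=
  AlgHom.ofLinearMap
    (LinearMap.applyₗ (1 : A) ∘ₗ (WithConv.linearEquiv k (A →ₗ[k] k)).toLinearMap)
    (by simp) (by intro f g; simp [Algebra.TensorProduct.one_def])

/-- The comultiplication `Δ : kG → kG ⊗ kG`, the transpose of the multiplication of `k[G]` under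
the identification `(k[G] ⊗ k[G])^* = kG ⊗ kG`. -/
noncomputable def comul [Module.Finite k A] :
    GroupAlg k A →ₗ[k] GroupAlg k A ⊗[k] GroupAlg k A :=
  (TensorProduct.congr (WithConv.linearEquiv k (A →ₗ[k] k)).symm
      (WithConv.linearEquiv k (A →ₗ[k] k)).symm).toLinearMap ∘ₗ
    (TensorProduct.dualDistribEquiv k A A).symm.toLinearMap ∘ₗ
    (LinearMap.mul' k A).dualMap ∘ₗ (WithConv.linearEquiv k (A →ₗ[k] k)).toLinearMap

/-- The comultiplication is characterised by `(Δ f)(a ⊗ b) = f (a b)`. -/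
theorem comul_spec [Module.Finite k A] (f : GroupAlg k A) (a b : A) :
    TensorProduct.dualDistrib k A A
      (TensorProduct.congr (WithConv.linearEquiv k (A →ₗ[k] k))
        (WithConv.linearEquiv k (A →ₗ[k] k)) (comul k A f)) (a ⊗ₜ b) = f (a * b) := by
  have h : TensorProduct.congr (WithConv.linearEquiv k (A →ₗ[k] k))
        (WithConv.linearEquiv k (A →ₗ[k] k)) (comul k A f) =
      (TensorProduct.dualDistribEquiv k A A).symm
        ((LinearMap.mul' k A).dualMap f.ofConv) := by
    simp only [comul, LinearMap.comp_apply, LinearEquiv.coe_coe, ← TensorProduct.congr_symm,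
      LinearEquiv.apply_symm_apply]
    rfl
  rw [h]
  have h2 := (TensorProduct.dualDistribEquiv k A A).apply_symm_apply
    ((LinearMap.mul' k A).dualMap f.ofConv)
  have h3 := congrArg (fun φ => φ (a ⊗ₜ[k] b)) h2
  simpa using h3

/-- The comultiplication of the Hopf `R`-algebra `kG_R = R ⊗ kG`. -/
noncomputable def comulBaseChange [Module.Finite k A] (R : Type v) [CommRing R] [Algebra k R] :
    R ⊗[k] GroupAlg k A →ₗ[R] (R ⊗[k] GroupAlg k A) ⊗[R] (R ⊗[k] GroupAlg k A) :=
  (AlgebraTensorModule.distribBaseChange k R (GroupAlg k A) (GroupAlg k A)).toLinearMap ∘ₗ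
    (comul k A).baseChange R

/-- The trivial module `k` of the group algebra. -/
noncomputable def trivialModule : ModuleCat.{u} (GroupAlg k A) :=
  (ModuleCat.restrictScalars (augmentation k A).toRingHom).obj (ModuleCat.of k k)

end GroupAlg

/-- The complexity of a module `M` over a `k`-algebra `B`: the least `c` such that `M` has a
resolution by finitely generated projective modules `P n` with
`dim_k (P n) ≤ C * n ^ (c - 1)` for all `n ≥ 1` and some constant `C` (the inequality is multiplied
by `n`, to make sense of it for `c = 0`), and `⊤` if there is none. Over a finite-dimensional
algebra a minimal resolution is a direct summand of every other one, so that this is the rate of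
growth of the minimal projective resolution. -/
noncomputable def moduleComplexity (k : Type u) {B : Type u} [Field k] [Ring B] [Algebra k B]
    (M : ModuleCat.{u} B) : ℕ∞ :=
  ⨅ (c : ℕ) (_ : ∃ (P : ProjectiveResolution M) (C : ℕ),
      (∀ n, Module.Finite B (P.complex.X n)) ∧
      ∀ n : ℕ, 1 ≤ n →
        n * Module.finrank k
            ((ModuleCat.restrictScalars (algebraMap k B)).obj (P.complex.X n)) ≤ C * n ^ c),
    (c : ℕ∞)

/-- A closed subgroup scheme `E` of the group scheme `G` with coordinate ring `A = k[G]`: the closed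
subscheme that is cut out by a Hopf ideal of `A`. -/
@[ext]
structure SubgroupScheme (k A : Type u) [Field k] [CommRing A] [HopfAlgebra k A] where
  /-- The defining ideal of the subgroup scheme. -/
  ideal : Ideal A
  isHopfIdeal : ideal.IsHopfIdeal k

namespace SubgroupScheme

variable {k A : Type u} [Field k] [CommRing A] [HopfAlgebra k A]

attribute [instance] SubgroupScheme.isHopfIdeal

/-- The group algebra `kE` of the subgroup scheme `E`, whose coordinate ring is `k[E] = A ⧸ I`. -/
abbrev Alg (E : SubgroupScheme k A) : Type u := GroupAlg k (A ⧸ E.ideal)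

/-- The map `kE → kG` that is induced by the inclusion of `E` in `G`, that is, the transpose of the
projection `k[G] → k[E]`. -/
noncomputable def inclusion (E : SubgroupScheme k A) : E.Alg →ₗ[k] GroupAlg k A :=
  (WithConv.linearEquiv k (A →ₗ[k] k)).symm.toLinearMap ∘ₗ
    LinearMap.lcomp k k (Ideal.Quotient.mkₐ k E.ideal).toLinearMap ∘ₗ
    (WithConv.linearEquiv k ((A ⧸ E.ideal) →ₗ[k] k)).toLinearMap

/-- The group algebra `kE`, as a subspace of `kG`. -/
noncomputable def space (E : SubgroupScheme k A) : Submodule k (GroupAlg k A) :=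
  LinearMap.range E.inclusion

/-- `E` is elementary abelian: the algebra `kE` is isomorphic to a truncated polynomial ring
`k[x₁, …, xₙ] / (x₁ᵖ, …, xₙᵖ)`. -/
def IsElementaryAbelian (p : ℕ) (E : SubgroupScheme k A) : Prop :=
  ∃ n : ℕ, Nonempty (E.Alg ≃ₐ[k]
    (MvPolynomial (Fin n) k ⧸
      Ideal.span (Set.range fun i : Fin n => (MvPolynomial.X i : MvPolynomial (Fin n) k) ^ p)))

/-- The complexity `cx_E(k)` of the trivial `kE`-module. -/
noncomputable def complexity (E : SubgroupScheme k A) : ℕ∞ :=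
  moduleComplexity k (GroupAlg.trivialModule k (A ⧸ E.ideal))

end SubgroupScheme

/-- The set of elementary abelian subgroup schemes of complexity `ℓ` of the finite group scheme with
coordinate ring `A`. -/
def elementaryAbelianOfComplexity (k A : Type u) [Field k] [CommRing A] [HopfAlgebra k A]
    (p ℓ : ℕ) : Set (SubgroupScheme k A) :=
  {E | E.IsElementaryAbelian p ∧ E.complexity = ℓ}

/-! ### The Grassmann functor and its closed subfunctors -/

section GrassmannFunctor

variable (k : Type u) [Field k] (V : Type u) [AddCommGroup V] [Module k V]

/-- The points `Gr_d(V)(R)` of the Grassmann functor: the direct summands of rank `d` of the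
`R`-module `V_R = R ⊗ V`. -/
def grassmannPoints (d : ℕ) (R : Type v) [CommRing R] [Algebra k R] :
    Set (Submodule R (R ⊗[k] V)) :=
  {W | (∃ W' : Submodule R (R ⊗[k] V), IsCompl W W') ∧
    ∀ 𝔭 : PrimeSpectrum R, Module.rankAtStalk (R := R) W 𝔭 = d}

variable {k V}

/-- The map `Gr_d(V)(ψ)` for `ψ : B → R`: it sends a direct summand `W` of `V_B` to the direct
summand of `V_R` that is spanned by the image of `W` (which is `R ⊗_B W`). -/
noncomputable def grassmannMap {B R : Type v} [CommRing B] [Algebra k B] [CommRing R] [Algebra k R]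
    (ψ : B →ₐ[k] R) (W : Submodule B (B ⊗[k] V)) : Submodule R (R ⊗[k] V) :=
  Submodule.span R (LinearMap.rTensor V ψ.toLinearMap '' W)

/-- `F` is a closed subfunctor of the Grassmann functor `Gr_d(V)`: it is a subfunctor and, for every
commutative `k`-algebra `B` and every morphism `Spec B → Gr_d(V)`, that is, every point `W` of
`Gr_d(V)(B)`, the inverse image of `F` is the closed subfunctor of `Spec B` of an ideal `I`. -/
def IsClosedGrassmannSubfunctor (d : ℕ)
    (F : ∀ (R : Type v) [CommRing R] [Algebra k R], Set (Submodule R (R ⊗[k] V))) : Prop :=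
  (∀ (R : Type v) [CommRing R] [Algebra k R], F R ⊆ grassmannPoints k V d R) ∧
  (∀ (B R : Type v) [CommRing B] [Algebra k B] [CommRing R] [Algebra k R] (ψ : B →ₐ[k] R),
    ∀ W ∈ F B, grassmannMap ψ W ∈ F R) ∧
  (∀ (B : Type v) [CommRing B] [Algebra k B], ∀ W ∈ grassmannPoints k V d B,
    ∃ I : Ideal B, ∀ (R : Type v) [CommRing R] [Algebra k R] (ψ : B →ₐ[k] R),
      grassmannMap ψ W ∈ F R ↔ ∀ b ∈ I, ψ b = 0)

end GrassmannFunctor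

/-- The functor `Sub_d(kG)`: its `R`-points are the direct summands `W` of rank `d` of `R ⊗ kG` with
`W · W ⊆ W` and `Δ(W) ⊆ W ⊗_R W`. -/
def subPoints (k A : Type u) [Field k] [CommRing A] [HopfAlgebra k A] [Module.Finite k A]
    (d : ℕ) (R : Type v) [CommRing R] [Algebra k R] :
    Set (Submodule R (R ⊗[k] GroupAlg k A)) :=
  {W | W ∈ grassmannPoints k (GroupAlg k A) d R ∧
    (∀ x ∈ W, ∀ y ∈ W, x * y ∈ W) ∧
    ∀ x ∈ W, GroupAlg.comulBaseChange k A R x ∈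
      LinearMap.range (TensorProduct.map W.subtype W.subtype)}

/-! ### The Grassmann variety as a projective variety -/

section GrassmannVariety

variable (k : Type u) [Field k] (V : Type u) [AddCommGroup V] [Module k V]

/-- A subset of the projective space `ℙ(V)` is Zariski closed if it is the set of common zeros of a
set of homogeneous polynomials, here written as polynomials in the linear forms on `V`. -/
def IsProjectiveClosed (Z : Set (ℙ k V)) : Prop :=
  ∃ S : Set (MvPolynomial (Module.Dual k V) k), (∀ F ∈ S, ∃ n : ℕ, F.IsHomogeneous n) ∧
    Z = {x | ∀ F ∈ S, MvPolynomial.eval (fun φ : Module.Dual k V => φ x.rep) F = 0}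

/-- The `k`-rational points of the Grassmannian: the `d`-dimensional subspaces of `V`. -/
abbrev GrassmannVariety (d : ℕ) : Type u := {W : Submodule k V // Module.finrank k W = d}

variable {k V}

theorem finrank_range_exteriorPower_map [Module.Finite k V] (d : ℕ) (W : GrassmannVariety k V d) :
    Module.finrank k (LinearMap.range (exteriorPower.map d W.1.subtype)) = 1 := by
  rw [LinearMap.finrank_range_of_inj
    (exteriorPower.map_injective_field (Submodule.injective_subtype W.1)),
    exteriorPower.finrank_eq, W.2, Nat.choose_self]

/-- The Plücker embedding of the Grassmannian, which sends `W` to the line `⋀^d W` in `⋀^d V`. -/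
noncomputable def plucker [Module.Finite k V] (d : ℕ) (W : GrassmannVariety k V d) :
    ℙ k (⋀[k]^d V) :=
  Projectivization.mk'' (LinearMap.range (exteriorPower.map d W.1.subtype))
    (finrank_range_exteriorPower_map d W)

/-- A set of `d`-dimensional subspaces of `V` is a projective variety (a closed subset of the
Grassmannian) if its image under the Plücker embedding is Zariski closed in `ℙ(⋀^d V)`. -/
def IsProjectiveGrassmannSubvariety [Module.Finite k V] (d : ℕ)
    (Z : Set (GrassmannVariety k V d)) : Prop :=
  IsProjectiveClosed k (⋀[k]^d V) (plucker d '' Z)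

end GrassmannVariety

/-!
Part (a) is linear algebra. A direct summand `W` of `R ⊗ kG` is the range of an idempotent `e`, and
`W · W ⊆ W` and `Δ(W) ⊆ W ⊗ W` mean that `(1 - e)(x y)` and `(1 - e ⊗ e)(Δ x)` vanish for `x`, `y`
in `W`. The coordinates of these elements generate the ideal that cuts out the condition, because
everything commutes with base change (`isClosedGrassmannSubfunctor_subPoints`).

Part (b) rests on three facts.

*Complexity.* If `kE` is a truncated polynomial ring in `n` variables, then `kE` has dimension
`p ^ n`, and the complexity of the trivial module is `n`
(`moduleComplexity_residueModule`). The tensor product of the periodic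
resolutions for the single variables is a minimal resolution, given here with a contracting homotopy
over `k`; its ranks grow like `m ^ (n - 1)`, and a minimal resolution is a lower bound for all
others. Hence the elements of `ℭ(ℓ, G)` are the elementary abelian subgroup schemes with
`dim kE = p ^ ℓ`.

*Equations for elementary abelian subgroup schemes.* A subspace `W` of `kG` is the group algebra of a
closed subgroup scheme iff it contains `1` and is stable under products and under the action of
`k[G]` on its dual: its annihilator is then an ideal and a coideal, and in finite dimension it is
automatically stable under the antipode (`Ideal.antipode_mem_of_isCoideal`). Such a group algebra is
a truncated polynomial ring iff it is commutative and `(f - ε(f)) ^ p = 0` for all of its elements.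
The nontrivial direction is the structure theorem for coordinate rings of height one
(`HeightOne.nonempty_algEquiv_truncatedPolynomial`): every functional on `I / I²`, for the
augmentation ideal `I`, is induced by a derivation, and by differentiating one sees that lifts of a
basis of `I / I²` satisfy no relations but the vanishing of their `p`-th powers.

*Plücker coordinates.* For `ω ≠ 0` in `⋀ᵈ V`, the contractions of `ω` by `d - 1` functionals span a
space of dimension at least `d`, and the vectors `v` with `v ∧ ω = 0` form a space of dimension at
most `d`. If the former space is contained in the latter, both are equal to a subspace `W` with
`⋀ᵈ W = k ω`, so that the quadratic relations `L ω ∧ ω = 0` cut out the image of the Plücker embedding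
(`mem_range_plucker`). On this image the elements of `W` are the values `L ω`, and membership of
`v` in `W` is the equation `v ∧ ω = 0`. This turns the above conditions on `W` into homogeneous
equations for `ω` (`isProjectiveGrassmannSubvariety_subalgebra`).
-/

/-! ### Minimal free resolutions with a contracting homotopy -/

/-- A graded free resolution of the `R`-module `k` (on which `R` acts through `ε : R → k`), written
as one free module `Q` with a graded basis and a differential of degree `-1`. Exactness is witnessed
by an additive contracting homotopy `h` of the augmented complex, and minimality says that the
matrix of the differential has entries in the kernel of `ε`. The homotopy need not respect the
grading, since its components of the right degree serve the same purpose. -/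
structure MinimalResolution (k R : Type u) [Field k] [CommRing R] [Algebra k R]
    (ε : R →ₐ[k] k) where
  /-- The sum of the terms of the resolution. -/
  Q : Type u
  [addCommGroup : AddCommGroup Q]
  [module : Module R Q]
  /-- The index set of the homogeneous basis. -/
  ι : Type
  /-- A homogeneous basis. -/
  basis : Module.Basis ι R Q
  /-- The degrees of the basis elements. -/
  deg : ι → ℕ
  /-- The unique basis element of degree zero. -/
  base : ι
  deg_eq_zero_iff : ∀ i, deg i = 0 ↔ i = base
  /-- The differential. -/
  d : Q →ₗ[R] Q
  /-- The contracting homotopy. -/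
  h : Q →+ Q
  d_d : ∀ q, d (d q) = 0
  homotopy : ∀ q, d (h q) + h (d q) = q - algebraMap k R (ε (basis.repr q base)) • basis base
  deg_d : ∀ i l, basis.repr (d (basis i)) l ≠ 0 → deg l + 1 = deg i
  minimal : ∀ i l, ε (basis.repr (d (basis i)) l) = 0

attribute [instance] MinimalResolution.addCommGroup MinimalResolution.module

namespace MinimalResolution

/-- The resolution of `k` over `R` when `R = k`, concentrated in degree zero. -/
noncomputable def self {k R : Type u} [Field k] [CommRing R] [Algebra k R] (ε : R →ₐ[k] k)
    (hε : ∀ r, algebraMap k R (ε r) = r) : MinimalResolution k R ε where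
  Q := R
  ι := Unit
  basis := Module.Basis.singleton Unit R
  deg _ := 0
  base := ()
  deg_eq_zero_iff := by simp
  d := 0
  h := 0
  d_d := by simp
  homotopy q := by simp [hε]
  deg_d := by simp
  minimal := by simp

section Step

variable {k B S : Type u} [Field k] [CommRing B] [CommRing S] [Algebra k B]
  [Algebra B S] {ε : B →ₐ[k] k} (M : MinimalResolution k B ε) (x y : S)
  (q t : S →ₗ[B] S) (c : S →ₗ[B] B)

/-- The extension of scalars of the module `M.Q` to `S`, in the coordinates of its basis. -/
def ExtendedModule (S : Type u) [CommRing S] (M : MinimalResolution k B ε) : Type u :=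
  M.ι →₀ S

noncomputable instance : AddCommGroup (M.ExtendedModule S) :=
  inferInstanceAs (AddCommGroup (M.ι →₀ S))

noncomputable instance (R : Type u) [CommRing R] [Algebra R S] : Module R (M.ExtendedModule S) :=
  inferInstanceAs (Module R (M.ι →₀ S))

/-- The basis of the extension of scalars that is induced by the basis of `M`. -/
noncomputable def extendedBasis (S : Type u) [CommRing S] (M : MinimalResolution k B ε) :
    Module.Basis M.ι S (M.ExtendedModule S) :=
  Module.Basis.ofRepr (LinearEquiv.refl S (M.ι →₀ S))

/-- The total module of the tensor product of `M` with the periodic resolution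
`⋯ → S → S → S` over `S`. -/
abbrev TotalModule (S : Type u) [CommRing S] (M : MinimalResolution k B ε) : Type u :=
  ℕ →₀ M.ExtendedModule S

/-- The element `u ⊗ v` of the extension of scalars of `M.Q`. -/
noncomputable def tmul (u : S) (v : M.Q) : M.ExtendedModule S :=
  u • (M.extendedBasis S).repr.symm
    (Finsupp.mapRange.linearMap (Algebra.linearMap B S) (M.basis.repr v))

/-- The map that applies a linear map to every coordinate. -/
noncomputable def mapCoords {S' : Type u} [CommRing S'] [Algebra B S'] (f : S →ₗ[B] S') :
    M.ExtendedModule S →ₗ[B] M.ExtendedModule S' :=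
  (Finsupp.mapRange.linearMap f : (M.ι →₀ S) →ₗ[B] (M.ι →₀ S'))

lemma mapCoords_repr {S' : Type u} [CommRing S'] [Algebra B S'] (f : S →ₗ[B] S')
    (w : M.ExtendedModule S) (i : M.ι) :
    (M.extendedBasis S').repr (M.mapCoords f w) i = f ((M.extendedBasis S).repr w i) := rfl

lemma tmul_repr (u : S) (v : M.Q) (i : M.ι) :
    (M.extendedBasis S).repr (M.tmul u v) i = u * algebraMap B S (M.basis.repr v i) := by
  simp [tmul]

lemma tmul_basis (u : S) (i : M.ι) : M.tmul u (M.basis i) = u • M.extendedBasis S i := by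
  simp [tmul]

lemma tmul_add (u : S) (v w : M.Q) : M.tmul u (v + w) = M.tmul u v + M.tmul u w := by
  simp only [tmul, map_add, smul_add]

lemma add_tmul (u w : S) (v : M.Q) : M.tmul (u + w) v = M.tmul u v + M.tmul w v := by
  simp [tmul, add_smul]

@[simp] lemma tmul_zero (u : S) : M.tmul u (0 : M.Q) = 0 := by simp [tmul]

@[simp] lemma zero_tmul (v : M.Q) : M.tmul (0 : S) v = 0 := by simp [tmul]

lemma smul_tmul (s u : S) (v : M.Q) : s • M.tmul u v = M.tmul (s * u) v := by
  simp [tmul, mul_smul]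

lemma tmul_smul (u : S) (b : B) (v : M.Q) : M.tmul u (b • v) = algebraMap B S b • M.tmul u v := by
  apply (M.extendedBasis S).ext_elem
  intro i
  simp only [tmul_repr, map_smul, Finsupp.smul_apply, smul_eq_mul, map_mul]
  ring

lemma mapCoords_tmul {S' : Type u} [CommRing S'] [Algebra B S'] (f : S →ₗ[B] S') (u : S)
    (v : M.Q) : M.mapCoords f (M.tmul u v) = M.tmul (f u) v := by
  apply (M.extendedBasis S').ext_elem
  intro i
  rw [mapCoords_repr, tmul_repr, tmul_repr, mul_comm, ← Algebra.smul_def, map_smul,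
    Algebra.smul_def, mul_comm]

lemma repr_symm_tmul (b : B) (v : M.Q) :
    M.basis.repr.symm ((M.extendedBasis B).repr (M.tmul b v)) = b • v := by
  rw [LinearEquiv.symm_apply_eq]
  ext i
  rw [tmul_repr]
  simp

lemma induction_on_basis {R N ι : Type*} [CommRing R] [AddCommGroup N] [Module R N]
    (b : Module.Basis ι R N) {P : N → Prop} (zero : P 0) (add : ∀ v w, P v → P w → P (v + w))
    (smul : ∀ (r : R) i, P (r • b i)) (v : N) : P v := by
  rw [← b.linearCombination_repr v]
  induction b.repr v using Finsupp.induction_linear with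
  | zero => simpa using zero
  | add f g hf hg => simpa using add _ _ hf hg
  | single i r => simpa using smul r i

lemma induction_on_single_tmul {P : M.TotalModule S → Prop} (zero : P 0)
    (add : ∀ a b, P a → P b → P (a + b))
    (single : ∀ j u v, P (Finsupp.single j (M.tmul u v))) (w : M.TotalModule S) : P w := by
  induction w using Finsupp.induction_linear with
  | zero => exact zero
  | add a b ha hb => exact add a b ha hb
  | single j w =>
    induction w using induction_on_basis (M.extendedBasis S) with
    | zero => simpa using zero
    | add a b ha hb => rw [Finsupp.single_add]; exact add _ _ ha hb
    | smul u i => rw [← tmul_basis]; exact single j u _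

/-- The differential of `M`, extended to `S`. -/
noncomputable def extendedD (S : Type u) [CommRing S] [Algebra B S]
    (M : MinimalResolution k B ε) : M.ExtendedModule S →ₗ[S] M.ExtendedModule S :=
  (M.extendedBasis S).constr S fun i => M.tmul 1 (M.d (M.basis i))

lemma extendedD_tmul (u : S) (v : M.Q) : M.extendedD S (M.tmul u v) = M.tmul u (M.d v) := by
  induction v using induction_on_basis M.basis with
  | zero => simp
  | add a b ha hb => simp only [tmul_add, map_add, ha, hb]
  | smul b i => simp [tmul_smul, tmul_basis, extendedD, smul_tmul]

/-- The differential of the periodic direction: multiplication by `x` out of odd degrees and by `y`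
out of positive even degrees. -/
noncomputable def periodicD : M.TotalModule S →ₗ[S] M.TotalModule S :=
  Finsupp.lsum S fun j => match j with
    | 0 => 0
    | j + 1 => (if Even j then x else y) • Finsupp.lsingle j

/-- The differential of the total complex. -/
noncomputable def totalD : M.TotalModule S →ₗ[S] M.TotalModule S :=
  M.periodicD x y +
    Finsupp.lsum S fun j => ((-1) ^ j : S) • (Finsupp.lsingle j ∘ₗ M.extendedD S)

/-- The homotopy of the periodic direction. -/
noncomputable def periodicH : M.TotalModule S →ₗ[B] M.TotalModule S :=
  Finsupp.lsum B fun j =>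
    Finsupp.lsingle (j + 1) ∘ₗ M.mapCoords (if Even j then q else t)

/-- The homotopy of `M`, on the constant coefficients of the elements of periodic degree zero. -/
noncomputable def constantH : M.TotalModule S →+ M.TotalModule S where
  toFun w := Finsupp.single 0
    (M.tmul 1 (M.h (M.basis.repr.symm ((M.extendedBasis B).repr (M.mapCoords c (w 0))))))
  map_zero' := by simp
  map_add' a b := by simp only [Finsupp.add_apply, map_add, tmul_add, Finsupp.single_add]

/-- The homotopy of the total complex. -/
noncomputable def totalH : M.TotalModule S →+ M.TotalModule S :=
  (M.periodicH q t).toAddMonoidHom + M.constantH c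

lemma totalD_zero (u : S) (v : M.Q) :
    M.totalD x y (Finsupp.single 0 (M.tmul u v)) = Finsupp.single 0 (M.tmul u (M.d v)) := by
  simp [totalD, periodicD, extendedD_tmul]

lemma totalD_succ (j : ℕ) (u : S) (v : M.Q) :
    M.totalD x y (Finsupp.single (j + 1) (M.tmul u v)) =
      Finsupp.single j (M.tmul ((if Even j then x else y) * u) v) +
      ((-1) ^ (j + 1) : S) • Finsupp.single (j + 1) (M.tmul u (M.d v)) := by
  by_cases hj : Even j <;> simp [totalD, periodicD, extendedD_tmul, hj, ← smul_tmul]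

lemma totalH_zero (u : S) (v : M.Q) :
    M.totalH q t c (Finsupp.single 0 (M.tmul u v)) =
      Finsupp.single 1 (M.tmul (q u) v) + Finsupp.single 0 (M.tmul 1 (M.h (c u • v))) := by
  have h : M.constantH c (Finsupp.single 0 (M.tmul u v)) =
      Finsupp.single 0 (M.tmul 1 (M.h (c u • v))) := by
    rw [← repr_symm_tmul, ← mapCoords_tmul]
    simp [constantH]
  rw [totalH, AddMonoidHom.add_apply, h]
  simp [periodicH, mapCoords_tmul]

lemma totalH_succ (j : ℕ) (u : S) (v : M.Q) :
    M.totalH q t c (Finsupp.single (j + 1) (M.tmul u v)) =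
      Finsupp.single (j + 2) (M.tmul ((if Even j then t else q) u) v) := by
  simp only [totalH, periodicH, AddMonoidHom.add_apply]
  by_cases hj : Even j <;>
  simp [constantH, mapCoords_tmul, Nat.even_add_one, hj]

variable {x y q t c}

lemma totalD_totalD (hxy : x * y = 0) (w : M.TotalModule S) :
    M.totalD x y (M.totalD x y w) = 0 := by
  have hyx : y * x = 0 := by rw [mul_comm, hxy]
  induction w using induction_on_single_tmul with
  | zero => simp
  | add a b ha hb => simp [ha, hb]
  | single j u v =>
    match j with
    | 0 => simp [totalD_zero, M.d_d]
    | 1 => rw [totalD_succ, map_add, map_smul, totalD_succ, totalD_zero]; simp [M.d_d]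
    | j + 2 =>
      rw [totalD_succ, map_add, map_smul, totalD_succ, totalD_succ]
      by_cases hj : Even j <;>
      simp [M.d_d, Nat.even_add_one, hj, ← mul_assoc, hxy, hyx, pow_succ]

lemma totalD_totalH [Algebra k S] [IsScalarTower k B S] (ε' : S →ₐ[k] k)
    (hε : ∀ b, ε' (algebraMap B S b) = ε b) (hc : ∀ u, ε' u = ε (c u))
    (h1 : ∀ u, x * q u = u - algebraMap B S (c u)) (h2 : ∀ u, q (x * u) + y * t u = u)
    (h3 : ∀ u, x * q u + t (y * u) = u) (h4 : ∀ u, c (x * u) = 0) (w : M.TotalModule S) :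
    M.totalD x y (M.totalH q t c w) + M.totalH q t c (M.totalD x y w) =
      w - algebraMap k S (ε' ((M.extendedBasis S).repr (w 0) M.base)) •
        Finsupp.single 0 (M.extendedBasis S M.base) := by
  have hneg : ∀ (j : ℕ) (w : M.TotalModule S),
      M.totalH q t c (((-1) ^ j : S) • w) = ((-1) ^ j : S) • M.totalH q t c w := by
    intro j w
    rcases neg_one_pow_eq_or S j with h | h <;> simp [h]
  induction w using induction_on_single_tmul with
  | zero => simp
  | add a b ha hb =>
    simp only [map_add, Finsupp.add_apply, add_smul]
    rw [add_add_add_comm, ha, hb]; abel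
  | single j u v =>
    match j with
    | 0 =>
      have e : M.tmul (1 : S) (M.d (M.h (c u • v))) + M.tmul (1 : S) (M.h (M.d (c u • v))) =
          M.tmul (algebraMap B S (c u)) v -
            algebraMap k S (ε' ((M.extendedBasis S).repr (M.tmul u v) M.base)) •
              M.extendedBasis S M.base := by
        rw [← tmul_add, M.homotopy]
        apply (M.extendedBasis S).ext_elem
        intro i
        rcases eq_or_ne i M.base with rfl | hi
        · simp [tmul_repr, hε, ← hc, IsScalarTower.algebraMap_apply k B S]
        · simp [tmul_repr, hi]
      have e' := congrArg (Finsupp.single (0 : ℕ)) e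
      rw [Finsupp.single_add, Finsupp.single_sub] at e'
      simp only [totalH_zero, totalD_zero, map_add, totalD_succ, Finsupp.single_eq_same, h1,
        Even.zero, if_true, zero_add, pow_one, ← map_smul]
      rw [← sub_eq_zero] at e' ⊢
      rw [← e', sub_eq_add_neg u, add_tmul, Finsupp.single_add]
      have e1 : M.tmul (-algebraMap B S (c u)) v = -M.tmul (algebraMap B S (c u)) v := by
        rw [← neg_one_mul, ← smul_tmul, neg_smul, one_smul]
      rw [e1, Finsupp.single_neg]
      simp only [neg_smul, one_smul, ← Finsupp.smul_single]
      abel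
    | 1 =>
      simp only [totalH_succ, totalD_succ, map_add, hneg, totalH_zero, if_pos Even.zero, h4]
      simp [pow_succ]
      conv_rhs => rw [← h2 u, add_tmul, Finsupp.single_add]
      abel
    | j + 2 =>
      simp only [totalH_succ, totalD_succ, map_add, hneg]
      by_cases hj : Even j
      · simp [Nat.even_add_one, hj, pow_succ]
        conv_rhs => rw [← h3 u, add_tmul, Finsupp.single_add]
        rw [show j + 1 + 2 = j + 2 + 1 from rfl]
        abel
      · simp [Nat.even_add_one, hj, pow_succ]
        conv_rhs => rw [← h2 u, add_tmul, Finsupp.single_add]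
        rw [show j + 1 + 2 = j + 2 + 1 from rfl]
        abel


/-- The resolution of `k` over `S` that is obtained from one over `B`, when `S` looks like
`B[x] / (x * y)` with `y = x ^ (p - 1)`: the maps `c`, `q` and `t` are the constant coefficient,
the quotient by `x` and the coefficient of `y`. -/
noncomputable def total [Algebra k S] [IsScalarTower k B S] (ε' : S →ₐ[k] k)
    (hε : ∀ b, ε' (algebraMap B S b) = ε b) (hc : ∀ u, ε' u = ε (c u))
    (h1 : ∀ u, x * q u = u - algebraMap B S (c u)) (h2 : ∀ u, q (x * u) + y * t u = u)
    (h3 : ∀ u, x * q u + t (y * u) = u) (h4 : ∀ u, c (x * u) = 0)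
    (hxy : x * y = 0) (hx : ε' x = 0) (hy : ε' y = 0) : MinimalResolution k S ε' where
  Q := M.TotalModule S
  ι := Σ _ : ℕ, M.ι
  basis := Finsupp.basis fun _ => M.extendedBasis S
  deg i := i.1 + M.deg i.2
  base := ⟨0, M.base⟩
  deg_eq_zero_iff i := by
    rw [Nat.add_eq_zero_iff, M.deg_eq_zero_iff, Sigma.ext_iff]
    simp
  d := M.totalD x y
  h := M.totalH q t c
  d_d := M.totalD_totalD hxy
  homotopy w := by
    simpa [Finsupp.basis_repr] using M.totalD_totalH ε' hε hc h1 h2 h3 h4 w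
  deg_d := by
    rintro ⟨j, a⟩ ⟨j', l⟩ h
    have ha : M.extendedBasis S a = M.tmul 1 (M.basis a) := by rw [tmul_basis, one_smul]
    have key : ∀ (n : ℕ) (u v : S), (M.extendedBasis S).repr
        ((Finsupp.single n (v • M.tmul u (M.d (M.basis a)))) j') l ≠ 0 →
        n = j' ∧ M.deg l + 1 = M.deg a := by
      intro n u v h'
      rcases eq_or_ne n j' with rfl | hn
      · rw [Finsupp.single_eq_same, map_smul, Finsupp.smul_apply, tmul_repr] at h'
        refine ⟨rfl, M.deg_d a l fun h0 => h' ?_⟩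
        simp [h0]
      · simp [Finsupp.single_eq_of_ne' hn] at h'
    simp only [Finsupp.coe_basis, Finsupp.basis_repr, ha] at h
    rcases j with _ | j
    · rw [totalD_zero, ← one_smul S (M.tmul _ _)] at h
      obtain ⟨rfl, h'⟩ := key _ _ _ h
      simpa using h'
    · rw [totalD_succ, Finsupp.add_apply, map_add, Finsupp.add_apply, Finsupp.smul_single] at h
      by_cases h' : (M.extendedBasis S).repr ((Finsupp.single (j + 1)
          ((-1 : S) ^ (j + 1) • M.tmul 1 (M.d (M.basis a)))) j') l = 0
      · rw [h', add_zero, tmul_basis] at h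
        rcases eq_or_ne j j' with rfl | hj
        · rw [Finsupp.single_eq_same, map_smul, Module.Basis.repr_self, Finsupp.smul_single] at h
          have : a = l := by
            by_contra hal
            exact h (Finsupp.single_eq_of_ne' hal)
          subst this
          simp only
          omega
        · simp [Finsupp.single_eq_of_ne' hj] at h
      · obtain ⟨h0, h1⟩ := key _ _ _ h'
        simp only
        omega
  minimal := by
    rintro ⟨j, a⟩ ⟨j', l⟩
    have ha : M.extendedBasis S a = M.tmul 1 (M.basis a) := by rw [tmul_basis, one_smul]
    have key : ∀ (n : ℕ) (u v : S), ε' ((M.extendedBasis S).repr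
        ((Finsupp.single n (v • M.tmul u (M.d (M.basis a)))) j') l) = 0 := by
      intro n u v
      rcases eq_or_ne n j' with rfl | hn
      · rw [Finsupp.single_eq_same, map_smul, Finsupp.smul_apply, tmul_repr, smul_eq_mul, map_mul,
          map_mul, hε, M.minimal, mul_zero, mul_zero]
      · simp [Finsupp.single_eq_of_ne' hn]
    simp only [Finsupp.coe_basis, Finsupp.basis_repr, ha]
    rcases j with _ | j
    · rw [totalD_zero, ← one_smul S (M.tmul _ _)]
      exact key _ _ _
    · rw [totalD_succ, Finsupp.add_apply, map_add, Finsupp.add_apply, Finsupp.smul_single, map_add,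
        key, add_zero, ← smul_tmul, ← Finsupp.smul_single, Finsupp.smul_apply, map_smul,
        Finsupp.smul_apply, smul_eq_mul, map_mul]
      split_ifs <;> simp [hx, hy]

end Step

lemma card_sigma_fiber {ι : Type} (deg : ι → ℕ) (n : ℕ)
    (h : ∀ m, Finite {i // deg i = m} ∧ Nat.card {i // deg i = m} = Nat.multichoose n m) (m : ℕ) :
    Finite {i : Σ _ : ℕ, ι // i.1 + deg i.2 = m} ∧
      Nat.card {i : Σ _ : ℕ, ι // i.1 + deg i.2 = m} = Nat.multichoose (n + 1) m := by
  induction m with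
  | zero =>
    let e : {i : Σ _ : ℕ, ι // i.1 + deg i.2 = 0} ≃ {i // deg i = 0} :=
      { toFun i := ⟨i.1.2, by have := i.2; omega⟩
        invFun i := ⟨⟨0, i.1⟩, by simpa using i.2⟩
        left_inv := by
          rintro ⟨⟨j, i⟩, hi⟩
          have : j = 0 := by simp only at hi; omega
          subst this
          rfl
        right_inv _ := rfl }
    have := (h 0).1
    exact ⟨Finite.of_equiv _ e.symm, by rw [Nat.card_congr e, (h 0).2]; simp⟩
  | succ m ih =>
    let e : {i : Σ _ : ℕ, ι // i.1 + deg i.2 = m + 1} ≃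
        {i // deg i = m + 1} ⊕ {i : Σ _ : ℕ, ι // i.1 + deg i.2 = m} :=
      { toFun i := match i with
          | ⟨⟨0, i⟩, hi⟩ => Sum.inl ⟨i, by simpa using hi⟩
          | ⟨⟨j + 1, i⟩, hi⟩ => Sum.inr ⟨⟨j, i⟩, by simp only at hi ⊢; omega⟩
        invFun := Sum.elim (fun i => ⟨⟨0, i.1⟩, by simpa using i.2⟩)
          (fun i => ⟨⟨i.1.1 + 1, i.1.2⟩, by have := i.2; simp only; omega⟩)
        left_inv := by rintro ⟨⟨_ | j, i⟩, hi⟩ <;> rfl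
        right_inv := by rintro (i | i) <;> rfl }
    have := (h (m + 1)).1
    have := ih.1
    refine ⟨Finite.of_equiv _ e.symm, ?_⟩
    rw [Nat.card_congr e, Nat.card_sum, (h (m + 1)).2, ih.2, Nat.multichoose_succ_succ]

end MinimalResolution

/-! ### Truncated polynomial rings -/

/-- The truncated polynomial ring `k[x₁, …, xₙ] / (x₁ᵖ, …, xₙᵖ)`. -/
abbrev TruncatedPolynomial (k : Type u) [Field k] (p n : ℕ) : Type u :=
  MvPolynomial (Fin n) k ⧸
    Ideal.span (Set.range fun i : Fin n => (MvPolynomial.X i : MvPolynomial (Fin n) k) ^ p)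

namespace TruncatedPolynomial

variable (k : Type u) [Field k] (p : ℕ) {n : ℕ}

/-- The variables of the truncated polynomial ring. -/
noncomputable def X (i : Fin n) : TruncatedPolynomial k p n :=
  Ideal.Quotient.mk _ (MvPolynomial.X i)

lemma X_pow (i : Fin n) : X k p i ^ p = 0 := by
  rw [X, ← map_pow]
  exact Ideal.Quotient.eq_zero_iff_mem.2 (Ideal.subset_span ⟨i, rfl⟩)

variable {k p} {R : Type*} [CommRing R] [Algebra k R]

/-- The algebra homomorphism with given values at the variables. -/
noncomputable def lift (x : Fin n → R) (hx : ∀ i, x i ^ p = 0) : TruncatedPolynomial k p n →ₐ[k] R :=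
  Ideal.Quotient.liftₐ _ (MvPolynomial.aeval x) fun a ha => by
    have : Ideal.span (Set.range fun i : Fin n => (MvPolynomial.X i : MvPolynomial (Fin n) k) ^ p) ≤
        RingHom.ker (MvPolynomial.aeval x : MvPolynomial (Fin n) k →ₐ[k] R) := by
      rw [Ideal.span_le]
      rintro _ ⟨i, rfl⟩
      simp [hx]
    exact this ha

@[simp] lemma lift_X (x : Fin n → R) (hx : ∀ i, x i ^ p = 0) (i : Fin n) :
    lift (k := k) x hx (X k p i) = x i := by
  change MvPolynomial.aeval x (MvPolynomial.X i) = x i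
  simp

lemma algHom_ext {f g : TruncatedPolynomial k p n →ₐ[k] R}
    (h : ∀ i, f (X k p i) = g (X k p i)) : f = g := by
  refine Ideal.Quotient.algHom_ext _ (MvPolynomial.algHom_ext h)

lemma algHom_field_X (f : TruncatedPolynomial k p n →ₐ[k] k) (i : Fin n) : f (X k p i) = 0 := by
  have h := congrArg f (X_pow k p i)
  rw [map_pow, map_zero] at h
  exact eq_zero_of_pow_eq_zero h

/-- In characteristic `p`, the `p`-th power of an element is the `p`-th power of its constant
coefficient. -/
lemma pow_char [Fact p.Prime] [CharP k p] (f : TruncatedPolynomial k p n →ₐ[k] k)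
    (u : TruncatedPolynomial k p n) : u ^ p = algebraMap k _ (f u ^ p) := by
  have hc : CharP (TruncatedPolynomial k p n) p := by
    have : Nontrivial (TruncatedPolynomial k p n) := f.toRingHom.domain_nontrivial
    exact charP_of_injective_algebraMap (algebraMap k _).injective p
  have : (frobenius (TruncatedPolynomial k p n) p) =
      (algebraMap k _).comp ((frobenius k p).comp f.toRingHom) := by
    refine Ideal.Quotient.ringHom_ext (MvPolynomial.ringHom_ext (fun a => ?_) fun i => ?_)
    · have : Ideal.Quotient.mk _ (MvPolynomial.C a) =
          algebraMap k (TruncatedPolynomial k p n) a := rfl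
      simp [this, frobenius_def]
    · have h1 := algHom_field_X f i
      have h2 := X_pow k p i
      have h0 : p ≠ 0 := (Fact.out : p.Prime).ne_zero
      rw [X] at h1 h2
      simp [frobenius_def, h1, h2, h0]
  exact RingHom.congr_fun this u

lemma nontrivial (hp : p ≠ 0) : Nontrivial (TruncatedPolynomial k p n) :=
  (lift (p := p) (fun _ : Fin n => (0 : k)) (fun _ => zero_pow hp)).toRingHom.domain_nontrivial

/-- The truncated polynomial ring without variables. -/
noncomputable def zeroEquiv : TruncatedPolynomial k p 0 ≃ₐ[k] k :=
  AlgEquiv.ofAlgHom (lift Fin.elim0 fun i => i.elim0) (Algebra.ofId k _) (by ext)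
    (algHom_ext fun i => i.elim0)

variable (k p n) in
/-- The inclusion of the truncated polynomial ring in the last `n` variables. -/
noncomputable def inclusion : TruncatedPolynomial k p n →ₐ[k] TruncatedPolynomial k p (n + 1) :=
  lift (fun i => X k p i.succ) fun i => X_pow k p i.succ

/-- The truncated polynomial ring in `n + 1` variables is free over the one in `n` variables, and
the powers of the first variable are a basis. -/
lemma exists_basis {S : Type u} [CommRing S] [Algebra k S] (hp : p ≠ 0)
    (e : TruncatedPolynomial k p (n + 1) ≃ₐ[k] S)
    [Algebra (TruncatedPolynomial k p n) S] [IsScalarTower k (TruncatedPolynomial k p n) S]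
    (he : ∀ t, algebraMap _ S t = e (inclusion k p n t)) :
    ∃ b : Module.Basis (Fin p) (TruncatedPolynomial k p n) S, ∀ a, b a = e (X k p 0) ^ (a : ℕ) := by
  have hT : Nontrivial (TruncatedPolynomial k p n) := nontrivial hp
  have he' : ∀ i, algebraMap _ S (X k p i) = e (X k p (Fin.succ i)) := fun i => by
    rw [he, inclusion, lift_X]
  have hm : (Polynomial.X ^ p : Polynomial (TruncatedPolynomial k p n)).Monic := Polynomial.monic_X_pow p
  let f : AdjoinRoot (Polynomial.X ^ p : Polynomial (TruncatedPolynomial k p n)) →ₐ[TruncatedPolynomial k p n] S :=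
    AdjoinRoot.liftAlgHom _ (Algebra.ofId (TruncatedPolynomial k p n) S) (e (X k p 0))
      (by simp [← map_pow, X_pow])
  let g : S →ₐ[k] AdjoinRoot (Polynomial.X ^ p : Polynomial (TruncatedPolynomial k p n)) :=
    (lift (Fin.cons (AdjoinRoot.root _) fun i => AdjoinRoot.of _ (X k p i)) (by
      intro i
      refine Fin.cases ?_ (fun i => ?_) i
      · have := AdjoinRoot.eval₂_root (Polynomial.X ^ p : Polynomial (TruncatedPolynomial k p n))
        simpa using this
      · simp [← map_pow, X_pow])).comp e.symm.toAlgHom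
  have hfg : ∀ s, f (g s) = s := by
    have : ((f.restrictScalars k).comp g).comp e.toAlgHom = e.toAlgHom := by
      refine algHom_ext fun i => ?_
      refine Fin.cases ?_ (fun i => ?_) i
      · simp [f, g]
      · simp [f, g, Algebra.ofId_apply, he']
    intro s
    have h := AlgHom.congr_fun this (e.symm s)
    simpa using h
  have hgf : ∀ s, g (f s) = s := by
    have h1 : (g.comp ((IsScalarTower.toAlgHom k (TruncatedPolynomial k p n) S))) =
        IsScalarTower.toAlgHom k _ (AdjoinRoot (Polynomial.X ^ p : Polynomial (TruncatedPolynomial k p n))) := by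
      refine algHom_ext fun i => ?_
      rw [AlgHom.comp_apply, IsScalarTower.toAlgHom_apply, he']
      simp [g]
    have : g.toRingHom.comp f.toRingHom = RingHom.id _ := by
      refine AdjoinRoot.ringHom_ext (RingHom.ext fun t => ?_) ?_
      · simpa [f] using AlgHom.congr_fun h1 t
      · simp [f, g]
    exact fun s => RingHom.congr_fun this s
  let E : AdjoinRoot (Polynomial.X ^ p : Polynomial (TruncatedPolynomial k p n)) ≃ₗ[TruncatedPolynomial k p n] S :=
    { f.toLinearMap with invFun := g, left_inv := hgf, right_inv := hfg }
  refine ⟨((AdjoinRoot.powerBasis' hm).basis.map E).reindex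
    (finCongr (by simp [AdjoinRoot.powerBasis'])), fun a => ?_⟩
  have : ∀ y, E y = f y := fun _ => rfl
  simp [this, f]

lemma finite_and_finrank_eq (hp : p ≠ 0) (n : ℕ) :
    Module.Finite k (TruncatedPolynomial k p n) ∧
      Module.finrank k (TruncatedPolynomial k p n) = p ^ n := by
  induction n with
  | zero =>
    exact ⟨Module.Finite.equiv (zeroEquiv (k := k) (p := p)).symm.toLinearEquiv, by
      simpa using (zeroEquiv (k := k) (p := p)).toLinearEquiv.finrank_eq⟩
  | succ n ih =>
    let := (inclusion k p n).toRingHom.toAlgebra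
    have : IsScalarTower k (TruncatedPolynomial k p n) (TruncatedPolynomial k p (n + 1)) :=
      IsScalarTower.of_algebraMap_eq' (inclusion k p n).comp_algebraMap.symm
    obtain ⟨b, -⟩ := exists_basis (k := k) (n := n) hp AlgEquiv.refl fun t => rfl
    have := Module.Free.of_basis b
    have := Module.Finite.of_basis b
    have := nontrivial (k := k) (n := n) hp
    have := ih.1
    refine ⟨Module.Finite.trans (TruncatedPolynomial k p n) _, ?_⟩
    rw [← Module.finrank_mul_finrank k (TruncatedPolynomial k p n), ih.2,
      Module.finrank_eq_card_basis b, Fintype.card_fin, pow_succ]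

end TruncatedPolynomial

/-! ### The minimal resolution over a truncated polynomial ring -/

namespace MinimalResolution

variable {k B S : Type u} [Field k] [CommRing B] [CommRing S] [Algebra k B] [Algebra k S]
  [Algebra B S] [IsScalarTower k B S] {ε : B →ₐ[k] k}

/-- A minimal resolution over `B` extends to one over a `B`-algebra with basis `1, x, …, x ^ (p-1)`
and `x ^ p = 0`; each basis element of the old resolution contributes one basis element in each
higher degree. -/
lemma exists_total (M : MinimalResolution k B ε) {p : ℕ} (hp : 2 ≤ p) {x : S}
    (b : Module.Basis (Fin p) B S) (hb : ∀ a, b a = x ^ (a : ℕ)) (hx : x ^ p = 0)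
    (ε' : S →ₐ[k] k) (hε : ∀ t, ε' (algebraMap B S t) = ε t) :
    ∃ M' : MinimalResolution k S ε', ∃ e : M'.ι ≃ (Σ _ : ℕ, M.ι),
      ∀ i, M'.deg i = (e i).1 + M.deg (e i).2 := by
  have hx0 : ε' x = 0 := eq_zero_of_pow_eq_zero (by rw [← map_pow, hx, map_zero])
  have : NeZero p := ⟨by omega⟩
  let c : S →ₗ[B] B := b.coord 0
  let q : S →ₗ[B] S := b.constr B fun a => if (a : ℕ) = 0 then 0 else x ^ ((a : ℕ) - 1)
  let t : S →ₗ[B] S := (b.coord ⟨p - 1, by omega⟩).smulRight 1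
  have hc : ∀ a : ℕ, a < p → c (x ^ a) = if a = 0 then 1 else 0 := by
    intro a ha
    have := hb ⟨a, ha⟩
    simp only at this
    simp [c, ← this, Finsupp.single_apply, Fin.ext_iff]
  have hq : ∀ a : ℕ, a < p → q (x ^ a) = if a = 0 then 0 else x ^ (a - 1) := by
    intro a ha
    have := hb ⟨a, ha⟩
    simp only at this
    simp only [q, ← this, Module.Basis.constr_basis]
  have ht : ∀ a : ℕ, a < p → t (x ^ a) = if a = p - 1 then 1 else 0 := by
    intro a ha
    have := hb ⟨a, ha⟩
    simp only at this
    simp [t, ← this, Finsupp.single_apply, Fin.ext_iff]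
  -- It suffices to check linear identities on the powers of `x`.
  have ext : ∀ {f g : S →ₗ[B] S}, (∀ a : ℕ, a < p → f (x ^ a) = g (x ^ a)) → ∀ u, f u = g u := by
    intro f g h u
    have : f = g := b.ext fun a => by rw [hb, h a a.2]
    rw [this]
  have h1 : ∀ u, x * q u + algebraMap B S (c u) = u :=
    ext (f := LinearMap.mulLeft B x ∘ₗ q + Algebra.linearMap B S ∘ₗ c) (g := LinearMap.id)
      fun a ha => by
        rcases a with _ | a
        · simp only [LinearMap.add_apply, LinearMap.comp_apply, hq 0 ha, hc 0 ha]; simp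
        · simp only [LinearMap.add_apply, LinearMap.comp_apply, hq _ ha, hc _ ha]; simp [pow_succ']
  have h2 : ∀ u, q (x * u) + x ^ (p - 1) * t u = u :=
    ext (f := q ∘ₗ LinearMap.mulLeft B x + LinearMap.mulLeft B (x ^ (p - 1)) ∘ₗ t)
      (g := LinearMap.id) fun a ha => by
        simp only [LinearMap.add_apply, LinearMap.comp_apply, LinearMap.mulLeft_apply, ← pow_succ',
          ht _ ha, LinearMap.id_apply]
        by_cases h : a = p - 1
        · subst h
          rw [Nat.sub_add_cancel (by omega), hx]
          simp
        · rw [hq _ (by omega)]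
          simp [h]
  have h3 : ∀ u, x * q u + t (x ^ (p - 1) * u) = u :=
    ext (f := LinearMap.mulLeft B x ∘ₗ q + t ∘ₗ LinearMap.mulLeft B (x ^ (p - 1)))
      (g := LinearMap.id) fun a ha => by
        simp only [LinearMap.add_apply, LinearMap.comp_apply, LinearMap.mulLeft_apply, ← pow_add,
          hq _ ha, LinearMap.id_apply]
        rcases a with _ | a
        · rw [ht _ (by omega)]; simp
        · rw [show p - 1 + (a + 1) = p + a by omega, pow_add x p, hx]
          simp [pow_succ']
  have h4 : ∀ u, c (x * u) = 0 := by
    have := ext (f := Algebra.linearMap B S ∘ₗ c ∘ₗ LinearMap.mulLeft B x) (g := 0) fun a ha => by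
      simp only [LinearMap.comp_apply, LinearMap.mulLeft_apply, ← pow_succ']
      rcases eq_or_ne (a + 1) p with h | h
      · rw [h, hx]; simp
      · rw [hc _ (by omega)]; simp
    intro u
    have hu : algebraMap B S (c (x * u)) = 0 := this u
    have := congrArg c hu
    rw [Algebra.algebraMap_eq_smul_one, map_smul, map_zero, ← pow_zero x, hc 0 (by omega)] at this
    simpa using this
  refine ⟨M.total (x := x) (y := x ^ (p - 1)) (q := q) (t := t) (c := c) ε' hε (fun u => ?_)
    (fun u => eq_sub_of_add_eq (h1 u)) h2 h3 h4 ?_ hx0 ?_, Equiv.refl _, fun i => rfl⟩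
  · conv_lhs => rw [← h1 u]
    simp [hx0, hε]
  · rw [← pow_succ', Nat.sub_add_cancel (by omega), hx]
  · rw [map_pow, hx0, zero_pow (by omega)]

/-- The residue field of a truncated polynomial ring in `n` variables has a minimal resolution whose
ranks are those of the polynomial ring in `n` variables. -/
theorem exists_of_truncatedPolynomial {p : ℕ} (hp : 2 ≤ p) (n : ℕ) :
    ∀ {S : Type u} [CommRing S] [Algebra k S] (_ : TruncatedPolynomial k p n ≃ₐ[k] S)
      (ε : S →ₐ[k] k), ∃ M : MinimalResolution k S ε, ∀ m,
        Finite {i // M.deg i = m} ∧ Nat.card {i // M.deg i = m} = Nat.multichoose n m := by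
  induction n with
  | zero =>
    intro S _ _ e ε
    have hε : ∀ s, algebraMap k S (ε s) = s := by
      intro s
      have : s = algebraMap k S (TruncatedPolynomial.zeroEquiv (e.symm s)) := by
        rw [← e.symm.injective.eq_iff, AlgEquiv.commutes, ← AlgEquiv.commutes
          (TruncatedPolynomial.zeroEquiv (k := k) (p := p)).symm, Algebra.algebraMap_self_apply,
          AlgEquiv.symm_apply_apply]
      rw [this, AlgHom.commutes, Algebra.algebraMap_self_apply]
    refine ⟨self ε hε, fun m => ⟨inferInstanceAs (Finite {i : Unit // _}), ?_⟩⟩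
    change Nat.card {i : Unit // 0 = m} = _
    rcases m with _ | m
    · simp
    · simp
  | succ n ih =>
    intro S _ _ e ε
    let := (e.toAlgHom.comp (TruncatedPolynomial.inclusion k p n)).toRingHom.toAlgebra
    have : IsScalarTower k (TruncatedPolynomial k p n) S := IsScalarTower.of_algebraMap_eq'
      (e.toAlgHom.comp (TruncatedPolynomial.inclusion k p n)).comp_algebraMap.symm
    obtain ⟨b, hb⟩ := TruncatedPolynomial.exists_basis (k := k) (n := n) (by omega) e fun t => rfl
    obtain ⟨M, hM⟩ := ih AlgEquiv.refl
      (ε.comp (e.toAlgHom.comp (TruncatedPolynomial.inclusion k p n)))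
    obtain ⟨M', f, hf⟩ := M.exists_total hp b hb
      (by rw [← map_pow, TruncatedPolynomial.X_pow, map_zero]) ε fun t => rfl
    refine ⟨M', fun m => ?_⟩
    let E : {i // M'.deg i = m} ≃ {i : Σ _ : ℕ, M.ι // i.1 + M.deg i.2 = m} :=
      f.subtypeEquiv fun i => by rw [hf]
    have := card_sigma_fiber M.deg n hM m
    have := this.1
    exact ⟨Finite.of_equiv _ E.symm, by rw [Nat.card_congr E, (card_sigma_fiber M.deg n hM m).2]⟩

end MinimalResolution

/-! ### The complexity of the trivial module of a truncated polynomial ring -/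

section OfExact

variable {R : Type u} [Ring R] (F : ℕ → Type u) [∀ m, AddCommGroup (F m)] [∀ m, Module R (F m)]
  (d : ∀ m, F (m + 1) →ₗ[R] F m) {Z : ModuleCat.{u} R} (a : F 0 →ₗ[R] Z)

/-- The chain complex of a sequence of modules and linear maps. -/
noncomputable def chainComplexOfLinearMap (h : ∀ m, d m ∘ₗ d (m + 1) = 0) :
    ChainComplex (ModuleCat.{u} R) ℕ :=
  ChainComplex.of (fun m => ModuleCat.of R (F m)) (fun m => ModuleCat.ofHom (d m)) fun m => by
    rw [← ModuleCat.ofHom_comp, h]; rfl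

lemma chainComplexOfLinearMap_d (h : ∀ m, d m ∘ₗ d (m + 1) = 0) (m : ℕ) :
    (chainComplexOfLinearMap F d h).d (m + 1) m = ModuleCat.ofHom (d m) :=
  ChainComplex.of_d (V := ModuleCat.{u} R) (α := ℕ) (X := fun m => ModuleCat.of R (F m))
    (d := fun m => ModuleCat.ofHom (d m)) m

/-- The projective resolution given by an exact sequence of projective modules. -/
noncomputable def projectiveResolutionOfExact [∀ m, Module.Projective R (F m)]
    (h : ∀ m, Function.Exact (d (m + 1)) (d m)) (h0 : Function.Exact (d 0) a)
    (ha : Function.Surjective a) : ProjectiveResolution Z where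
  complex := chainComplexOfLinearMap F d fun m => (h m).linearMap_comp_eq_zero
  projective m := (IsProjective.iff_projective (R := R) (F m)).1 inferInstance
  π := (ChainComplex.toSingle₀Equiv _ _).symm ⟨ModuleCat.ofHom a, by
    rw [chainComplexOfLinearMap_d]
    exact (ModuleCat.ofHom_comp _ _).symm.trans
      (by rw [h0.linearMap_comp_eq_zero]; rfl)⟩
  quasiIso := ⟨fun m => by
    cases m with
    | zero =>
      rw [ChainComplex.quasiIsoAt₀_iff, ShortComplex.quasiIso_iff_of_zeros' _ rfl rfl rfl]
      have hd : ModuleCat.ofHom (d 0) ≫ (ModuleCat.ofHom a : ModuleCat.of R (F 0) ⟶ Z) = 0 :=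
        (ModuleCat.ofHom_comp _ _).symm.trans (by rw [h0.linearMap_comp_eq_zero]; rfl)
      refine (ShortComplex.exact_and_epi_g_iff_of_iso (S₂ := ShortComplex.mk _ _ hd) ?_).2
        ⟨(ShortComplex.moduleCat_exact_iff _).2 fun x hx => (h0 x).1 hx,
          (ModuleCat.epi_iff_surjective _).2 ha⟩
      refine ShortComplex.isoMk (Iso.refl _) (Iso.refl _) (Iso.refl _) ?_ ?_
      · exact (Category.id_comp _).trans
          ((chainComplexOfLinearMap_d F d (fun m => (h m).linearMap_comp_eq_zero) 0).symm.trans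
            (Category.comp_id _).symm)
      · refine (Category.id_comp (ModuleCat.ofHom a : ModuleCat.of R (F 0) ⟶ Z)).trans ?_
        refine Eq.trans ?_ (Category.comp_id _).symm
        exact (ChainComplex.toSingle₀Equiv_symm_apply_f_zero
          (C := chainComplexOfLinearMap F d fun m => (h m).linearMap_comp_eq_zero) (X := Z)
          (ModuleCat.ofHom a) _).symm
    | succ m =>
      rw [quasiIsoAt_iff_exactAt' _ _ (ChainComplex.exactAt_succ_single_obj _ _)]
      rw [HomologicalComplex.exactAt_iff' _ (m + 1 + 1) (m + 1) m (by simp) (by simp)]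
      rw [ShortComplex.moduleCat_exact_iff]
      intro x hx
      have h1 : ModuleCat.ofHom (d m) x = 0 := by
        rw [← chainComplexOfLinearMap_d F d fun m => (h m).linearMap_comp_eq_zero]
        exact hx
      obtain ⟨y, hy⟩ := (h m x).1 h1
      refine ⟨y, ?_⟩
      have h2 : ModuleCat.ofHom (d (m + 1)) y = x := hy
      rw [← chainComplexOfLinearMap_d F d fun m => (h m).linearMap_comp_eq_zero] at h2
      exact h2⟩

end OfExact

namespace MinimalResolution

variable {k R : Type u} [Field k] [CommRing R] [Algebra k R] {ε : R →ₐ[k] k}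
  (M : MinimalResolution k R ε)

/-- The term of degree `m`, in coordinates. -/
abbrev Term (m : ℕ) : Type u := {i // M.deg i = m} →₀ R

/-- The inclusion of the term of degree `m`. -/
noncomputable def incl (m : ℕ) : M.Term m →ₗ[R] M.Q :=
  Finsupp.linearCombination R fun i => M.basis i.1

/-- The projection onto the term of degree `m`. -/
noncomputable def proj (m : ℕ) : M.Q →ₗ[R] M.Term m :=
  Finsupp.lsubtypeDomain {i | M.deg i = m} ∘ₗ M.basis.repr.toLinearMap

lemma proj_apply (m : ℕ) (q : M.Q) (i : {i // M.deg i = m}) :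
    M.proj m q i = M.basis.repr q i.1 := rfl

lemma proj_incl (m : ℕ) (v : M.Term m) : M.proj m (M.incl m v) = v := by
  have : M.proj m ∘ₗ M.incl m = LinearMap.id := by
    refine Finsupp.lhom_ext' fun i => LinearMap.ext_ring ?_
    ext j
    simp only [LinearMap.comp_apply, LinearMap.id_apply, proj_apply, incl,
      Finsupp.lsingle_apply, Finsupp.linearCombination_single, one_smul, Module.Basis.repr_self]
    classical
    simp only [Finsupp.single_apply, Subtype.ext_iff]
  exact LinearMap.congr_fun this v

lemma incl_proj_basis (m : ℕ) (i : M.ι) :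
    M.incl m (M.proj m (M.basis i)) = if M.deg i = m then M.basis i else 0 := by
  split_ifs with h
  · have : M.basis i = M.incl m (Finsupp.single ⟨i, h⟩ 1) := by simp [incl]
    rw [this, proj_incl]
  · have : M.proj m (M.basis i) = 0 := by
      ext j
      rw [proj_apply, Module.Basis.repr_self, Finsupp.single_eq_of_ne]
      · rfl
      · rintro h'
        exact h (h' ▸ j.2)
    rw [this, map_zero]

lemma incl_proj_of_repr {m : ℕ} {q : M.Q} (h : ∀ l, M.basis.repr q l ≠ 0 → M.deg l = m) (n : ℕ) :
    M.incl n (M.proj n q) = if m = n then q else 0 := by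
  have hq := M.basis.linearCombination_repr q
  rw [Finsupp.linearCombination_apply, Finsupp.sum] at hq
  rw [← hq, map_sum, map_sum]
  simp only [map_smul, incl_proj_basis]
  have : ∀ l ∈ (M.basis.repr q).support,
      M.basis.repr q l • (if M.deg l = n then M.basis l else 0) =
      if m = n then M.basis.repr q l • M.basis l else 0 := by
    intro l hl
    rw [h l (Finsupp.mem_support_iff.1 hl)]
    split_ifs <;> simp
  rw [Finset.sum_congr rfl this]
  split_ifs <;> simp

lemma incl_proj_d (n : ℕ) (q : M.Q) :
    M.incl n (M.proj n (M.d q)) = M.d (M.incl (n + 1) (M.proj (n + 1) q)) := by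
  have : M.incl n ∘ₗ M.proj n ∘ₗ M.d = M.d ∘ₗ M.incl (n + 1) ∘ₗ M.proj (n + 1) := by
    refine M.basis.ext fun i => ?_
    simp only [LinearMap.comp_apply, incl_proj_basis]
    rcases hi : M.deg i with _ | m
    · have : M.d (M.basis i) = 0 := by
        apply M.basis.ext_elem
        intro l
        by_contra hl
        have := M.deg_d i l (by simpa using hl)
        omega
      simp [this]
    · rw [incl_proj_of_repr M (m := m)]
      · simp only [Nat.add_right_cancel_iff]
        split_ifs <;> simp
      · intro l hl
        have := M.deg_d i l hl
        omega
  exact LinearMap.congr_fun this q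

lemma d_incl_zero (v : M.Term 0) : M.d (M.incl 0 v) = 0 := by
  have : M.d ∘ₗ M.incl 0 = 0 := by
    refine Finsupp.lhom_ext' fun i => LinearMap.ext_ring ?_
    apply M.basis.ext_elem
    intro l
    by_contra hl
    have := M.deg_d i.1 l (by simpa [incl] using hl)
    have := i.2
    omega
  exact LinearMap.congr_fun this v

/-- The differential from degree `m + 1` to degree `m`. -/
noncomputable def termD (m : ℕ) : M.Term (m + 1) →ₗ[R] M.Term m :=
  M.proj m ∘ₗ M.d ∘ₗ M.incl (m + 1)

lemma incl_termD (m : ℕ) (v : M.Term (m + 1)) :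
    M.incl m (M.termD m v) = M.d (M.incl (m + 1) v) := by
  rw [termD, LinearMap.comp_apply, LinearMap.comp_apply, incl_proj_d, proj_incl]

lemma incl_injective (m : ℕ) : Function.Injective (M.incl m) :=
  Function.LeftInverse.injective (M.proj_incl m)

lemma repr_d_mem (q : M.Q) (l : M.ι) : ε (M.basis.repr (M.d q) l) = 0 := by
  induction q using induction_on_basis M.basis with
  | zero => simp
  | add v w hv hw => simp [hv, hw]
  | smul r i => simp [M.minimal]

/-- A cycle of degree `m` whose image under the augmentation vanishes is a boundary. -/
lemma exists_termD_eq {m : ℕ} {v : M.Term m} (hv : M.d (M.incl m v) = 0)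
    (h0 : ε (M.basis.repr (M.incl m v) M.base) = 0) : ∃ w, M.termD m w = v := by
  refine ⟨M.proj (m + 1) (M.h (M.incl m v)), M.incl_injective m ?_⟩
  have h := M.homotopy (M.incl m v)
  rw [hv, map_zero, add_zero, h0, map_zero, zero_smul, sub_zero] at h
  rw [incl_termD, ← incl_proj_d, h, proj_incl]

lemma repr_incl_of_ne {m : ℕ} (v : M.Term m) (l : M.ι) (hl : M.deg l ≠ m) :
    M.basis.repr (M.incl m v) l = 0 := by
  have : M.basis.coord l ∘ₗ M.incl m = 0 := by
    refine Finsupp.lhom_ext' fun i => LinearMap.ext_ring ?_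
    have : l ≠ i.1 := fun h => hl (h ▸ i.2)
    simp [incl, Finsupp.single_eq_of_ne this]
  exact LinearMap.congr_fun this v

lemma exact_termD (m : ℕ) : Function.Exact (M.termD (m + 1)) (M.termD m) := by
  intro v
  constructor
  · intro hv
    refine M.exists_termD_eq ?_ ?_
    · rw [← incl_termD, hv, map_zero]
    · have : M.basis.repr (M.incl (m + 1) v) M.base = 0 :=
        M.repr_incl_of_ne _ _ (by rw [(M.deg_eq_zero_iff _).2 rfl]; omega)
      rw [this, map_zero]
  · rintro ⟨w, rfl⟩
    apply M.incl_injective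
    rw [incl_termD, incl_termD, M.d_d, map_zero]

/-- The trivial module `k` of an augmented algebra. -/
noncomputable abbrev residueModule (ε : R →ₐ[k] k) : ModuleCat.{u} R :=
  (ModuleCat.restrictScalars ε.toRingHom).obj (ModuleCat.of k k)

/-- The augmentation of the resolution. -/
noncomputable def aug : M.Term 0 →ₗ[R] residueModule ε where
  toFun v := (ε (v ⟨M.base, (M.deg_eq_zero_iff _).2 rfl⟩) : k)
  map_add' _ _ := map_add ε _ _
  map_smul' _ _ := map_mul ε _ _

lemma aug_apply (v : M.Term 0) : M.aug v = (ε (M.basis.repr (M.incl 0 v) M.base) : k) := by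
  have : v ⟨M.base, (M.deg_eq_zero_iff _).2 rfl⟩ = M.basis.repr (M.incl 0 v) M.base := by
    conv_lhs => rw [← M.proj_incl 0 v]
    rfl
  rw [← this]
  rfl

lemma exact_aug : Function.Exact (M.termD 0) M.aug := by
  intro v
  constructor
  · intro hv
    exact M.exists_termD_eq (M.d_incl_zero v) (by rwa [aug_apply] at hv)
  · rintro ⟨w, rfl⟩
    rw [aug_apply, incl_termD, repr_d_mem]
    rfl

lemma aug_surjective : Function.Surjective M.aug := by
  intro (a : k)
  refine ⟨Finsupp.single ⟨M.base, (M.deg_eq_zero_iff _).2 rfl⟩ (algebraMap k R a), ?_⟩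
  change ε (Finsupp.single _ _ _) = a
  rw [Finsupp.single_eq_same, AlgHom.commutes, Algebra.algebraMap_self_apply]

/-- A minimal resolution, as a projective resolution of the trivial module. -/
noncomputable def projectiveResolution : ProjectiveResolution (residueModule ε) :=
  projectiveResolutionOfExact M.Term M.termD M.aug M.exact_termD M.exact_aug M.aug_surjective

lemma mem_ker_smul_top {m : ℕ} {v : M.Term m} (h : ∀ i, ε (v i) = 0) :
    v ∈ RingHom.ker ε • (⊤ : Submodule R (M.Term m)) := by
  rw [← v.sum_single, Finsupp.sum]
  refine Submodule.sum_mem _ fun i _ => ?_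
  rw [← mul_one (v i), ← smul_eq_mul, ← Finsupp.smul_single]
  exact Submodule.smul_mem_smul (h i) trivial

lemma termD_mem (m : ℕ) (v : M.Term (m + 1)) :
    M.termD m v ∈ RingHom.ker ε • (⊤ : Submodule R (M.Term m)) :=
  M.mem_ker_smul_top fun _ => M.repr_d_mem _ _

/-- An endomorphism of a minimal resolution that is homotopic to the identity is surjective in each
degree, by Nakayama's lemma. -/
lemma surjective_of_homotopy (hnil : ∀ r, ε r = 0 → IsNilpotent r) (m : ℕ)
    [Finite {i // M.deg i = m}]
    (f : M.projectiveResolution.complex ⟶ M.projectiveResolution.complex)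
    (H : Homotopy f (𝟙 _)) : Function.Surjective (f.f m).hom := by
  have hprev : ∀ v : M.Term m, (prevD m H.hom).hom v ∈
      RingHom.ker ε • (⊤ : Submodule R (M.Term m)) := by
    intro v
    rw [Homotopy.prevD_chainComplex]
    have := M.termD_mem m ((H.hom m (m + 1)).hom v)
    rwa [← ModuleCat.hom_ofHom (M.termD m), ← chainComplexOfLinearMap_d M.Term M.termD
      fun m => (M.exact_termD m).linearMap_comp_eq_zero] at this
  have hnext : ∀ v : M.Term m, (dNext m H.hom).hom v ∈
      RingHom.ker ε • (⊤ : Submodule R (M.Term m)) := by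
    intro v
    cases m with
    | zero => rw [Homotopy.dNext_zero_chainComplex]; exact Submodule.zero_mem _
    | succ m =>
      rw [Homotopy.dNext_succ_chainComplex]
      have := Submodule.smul_top_le_comap_smul_top (RingHom.ker ε) (H.hom m (m + 1)).hom
        (M.termD_mem m v)
      rwa [← ModuleCat.hom_ofHom (M.termD m), ← chainComplexOfLinearMap_d M.Term M.termD
        fun m => (M.exact_termD m).linearMap_comp_eq_zero] at this
  rw [← LinearMap.range_eq_top, ← top_le_iff]
  refine Submodule.le_of_le_smul_of_le_jacobson_bot (I := RingHom.ker ε)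
    (Module.Finite.fg_top (R := R) (M := M.Term m)) ?_ ?_
  · rw [Ideal.jacobson_bot]
    exact le_trans (fun r hr => mem_nilradical.2 (hnil r hr)) (nilradical_le_jacobson R)
  · intro v _
    have h : (f.f m).hom v = (dNext m H.hom).hom v + (prevD m H.hom).hom v + v := by
      rw [H.comm m]
      rfl
    rw [Submodule.mem_sup]
    refine ⟨(f.f m).hom v, ⟨v, rfl⟩, -((dNext m H.hom).hom v + (prevD m H.hom).hom v),
      Submodule.neg_mem _ (Submodule.add_mem _ (hnext v) (hprev v)), ?_⟩
    rw [h]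
    abel

section Finrank

variable (k) in
/-- The dimension of a module over a `k`-algebra, computed after restriction of scalars to `k`. -/
lemma finrank_restrictScalars (N : Type u) [AddCommGroup N] [Module R N] [Module k N]
    [IsScalarTower k R N] :
    Module.finrank k ((ModuleCat.restrictScalars (algebraMap k R)).obj (ModuleCat.of R N)) =
      Module.finrank k N :=
  LinearEquiv.finrank_eq
    { toFun x := x
      invFun x := x
      map_add' _ _ := rfl
      map_smul' a x := algebraMap_smul (M := N) R a x
      left_inv _ := rfl
      right_inv _ := rfl }

lemma finrank_term (m : ℕ) :
    Module.finrank k ((ModuleCat.restrictScalars (algebraMap k R)).obj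
      (M.projectiveResolution.complex.X m)) =
      Nat.card {i // M.deg i = m} * Module.finrank k R := by
  refine (finrank_restrictScalars k (M.Term m)).trans ?_
  rw [Module.finrank, rank_finsupp, Cardinal.toNat_mul, Cardinal.toNat_lift, Cardinal.toNat_lift]
  rfl

/-- The terms of a minimal resolution have the least dimension among all resolutions by finitely
generated projective modules. -/
lemma finrank_term_le [Module.Finite k R] [∀ m, Finite {i // M.deg i = m}]
    (hnil : ∀ r, ε r = 0 → IsNilpotent r) (P : ProjectiveResolution (residueModule ε))
    (hP : ∀ m, Module.Finite R (P.complex.X m)) (m : ℕ) :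
    Nat.card {i // M.deg i = m} * Module.finrank k R ≤
      Module.finrank k ((ModuleCat.restrictScalars (algebraMap k R)).obj (P.complex.X m)) := by
  let he := ProjectiveResolution.homotopyEquiv M.projectiveResolution P
  have hs := M.surjective_of_homotopy hnil m _ he.homotopyHomInvId
  have hs' : Function.Surjective (he.inv.f m).hom := by
    intro v
    obtain ⟨w, hw⟩ := hs v
    exact ⟨(he.hom.f m).hom w, hw⟩
  let := Module.compHom (P.complex.X m) (algebraMap k R)
  have : IsScalarTower k R (P.complex.X m) := ⟨fun a r x => by
    rw [Algebra.smul_def a r, mul_smul]; rfl⟩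
  have := hP m
  have : Module.Finite k (P.complex.X m) := Module.Finite.trans R _
  have h : Module.finrank k ((ModuleCat.restrictScalars (algebraMap k R)).obj (P.complex.X m)) =
      Module.finrank k (P.complex.X m) := finrank_restrictScalars k (P.complex.X m)
  rw [← finrank_term, h]
  let g : P.complex.X m →ₗ[R] M.Term m := (he.inv.f m).hom
  exact (finrank_restrictScalars k (M.Term m)).le.trans
    (LinearMap.finrank_le_finrank_of_surjective (f := g.restrictScalars k) hs')

end Finrank

end MinimalResolution

lemma multichoose_growth (n D : ℕ) :
    ∃ C, ∀ m, 1 ≤ m → m * (Nat.multichoose n m * D) ≤ C * m ^ n := by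
  rcases n with _ | n
  · refine ⟨0, fun m hm => ?_⟩
    obtain ⟨m, rfl⟩ := Nat.exists_eq_add_of_le' hm
    simp
  · refine ⟨(n + 1) ^ n * D, fun m hm => ?_⟩
    have h : Nat.multichoose (n + 1) m ≤ (n + 1) ^ n * m ^ n := by
      rw [Nat.multichoose_eq, show n + 1 + m - 1 = n + m by omega, ← Nat.choose_symm_add,
        ← mul_pow]
      refine (Nat.choose_le_pow _ _).trans (Nat.pow_le_pow_left ?_ n)
      nlinarith
    calc m * (Nat.multichoose (n + 1) m * D) ≤ m * ((n + 1) ^ n * m ^ n * D) := by gcongr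
      _ = _ := by ring

lemma le_of_multichoose_growth {n c C D : ℕ} (hD : 1 ≤ D)
    (h : ∀ m, 1 ≤ m → m * (Nat.multichoose n m * D) ≤ C * m ^ c) : n ≤ c := by
  rcases n with _ | n
  · exact Nat.zero_le _
  by_contra! hc
  -- `m ^ n / n!` is a lower bound of the rank in degree `m`; take `m > n! * C`.
  set m := n.factorial * C + 1 with hm
  have h1 : m ^ n ≤ n.factorial * Nat.multichoose (n + 1) m := by
    rw [Nat.multichoose_eq, show n + 1 + m - 1 = m + n by omega, Nat.choose_symm_add,
      ← Nat.ascFactorial_eq_factorial_mul_choose]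
    exact (Nat.pow_le_pow_left (Nat.le_succ m) n).trans (Nat.pow_succ_le_ascFactorial _ _)
  have h2 : m * m ^ n ≤ (n.factorial * C) * m ^ n := by
    calc m * m ^ n ≤ m * (n.factorial * Nat.multichoose (n + 1) m * D) := by
            gcongr; exact h1.trans (Nat.le_mul_of_pos_right _ hD)
      _ = n.factorial * (m * (Nat.multichoose (n + 1) m * D)) := by ring
      _ ≤ n.factorial * (C * m ^ c) := Nat.mul_le_mul_left _ (h m (by omega))
      _ ≤ n.factorial * (C * m ^ n) := by gcongr <;> omega
      _ = _ := by ring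
  have h3 := Nat.le_of_mul_le_mul_right h2 (Nat.pow_pos (by omega))
  omega

/-- The trivial module of a truncated polynomial ring has complexity the number of variables. -/
theorem moduleComplexity_residueModule {k R : Type u} [Field k] [CommRing R] [Algebra k R] {p : ℕ}
    [Fact p.Prime] [CharP k p] {n : ℕ} (e : TruncatedPolynomial k p n ≃ₐ[k] R) (ε : R →ₐ[k] k) :
    moduleComplexity k (MinimalResolution.residueModule ε) = n := by
  have hp : p.Prime := Fact.out
  obtain ⟨M, hM⟩ := MinimalResolution.exists_of_truncatedPolynomial hp.two_le n e ε
  have := fun m => (hM m).1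
  obtain ⟨hfin, hrank⟩ := TruncatedPolynomial.finite_and_finrank_eq (k := k) hp.ne_zero n
  have : Module.Finite k R := Module.Finite.equiv e.toLinearEquiv
  have hD : 1 ≤ Module.finrank k R := by
    rw [← e.toLinearEquiv.finrank_eq, hrank]
    exact Nat.pow_pos hp.pos
  have hnil : ∀ r, ε r = 0 → IsNilpotent r := by
    intro r hr
    refine ⟨p, ?_⟩
    have h := TruncatedPolynomial.pow_char (ε.comp e.toAlgHom) (e.symm r)
    rw [← map_pow, AlgEquiv.symm_apply_eq] at h
    simpa [hr, hp.ne_zero] using h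
  apply le_antisymm
  · obtain ⟨C, hC⟩ := multichoose_growth n (Module.finrank k R)
    refine iInf₂_le n ⟨M.projectiveResolution, C, fun m => ?_, fun m hm => ?_⟩
    · exact inferInstanceAs (Module.Finite R (M.Term m))
    · rw [M.finrank_term, (hM m).2]
      exact hC m hm
  · refine le_iInf₂ fun c ⟨P, C, hfin, hle⟩ => Nat.cast_le.2 ?_
    refine le_of_multichoose_growth (C := C) hD fun m hm => le_trans ?_ (hle m hm)
    rw [← (hM m).2]
    exact Nat.mul_le_mul_left m (M.finrank_term_le hnil P hfin m)

/-! ### Base change of direct summands -/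

section BaseChange

variable {k : Type u} [Field k] {V : Type u} [AddCommGroup V] [Module k V]
variable {B R : Type v} [CommRing B] [Algebra k B] [CommRing R] [Algebra k R] (ψ : B →ₐ[k] R)

lemma rTensor_algHom_smul (b : B) (m : B ⊗[k] V) :
    LinearMap.rTensor V ψ.toLinearMap (b • m) = ψ b • LinearMap.rTensor V ψ.toLinearMap m := by
  induction m using TensorProduct.induction_on with
  | zero => simp
  | add m n hm hn => rw [smul_add, map_add, map_add, smul_add, hm, hn]
  | tmul c v => simp [TensorProduct.smul_tmul']

lemma span_range_rTensor :
    Submodule.span R (Set.range (LinearMap.rTensor V ψ.toLinearMap)) = ⊤ := by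
  rw [eq_top_iff]
  rintro m -
  induction m using TensorProduct.induction_on with
  | zero => exact Submodule.zero_mem _
  | add m n hm hn => exact Submodule.add_mem _ hm hn
  | tmul r v =>
    have : r ⊗ₜ[k] v = r • LinearMap.rTensor V ψ.toLinearMap (1 ⊗ₜ v) := by
      simp [TensorProduct.smul_tmul']
    rw [this]
    exact Submodule.smul_mem _ _ (Submodule.subset_span ⟨_, rfl⟩)

/-- A `B`-linear map out of `V_B` extends to an `R`-linear map out of `V_R`. -/
lemma exists_extension {N N' : Type*} [AddCommMonoid N] [Module B N] [AddCommMonoid N']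
    [Module R N']
    (e : B ⊗[k] V →ₗ[B] N) (f : N →+ N') (hf : ∀ b n, f (b • n) = ψ b • f n) :
    ∃ g : R ⊗[k] V →ₗ[R] N', ∀ m, g (LinearMap.rTensor V ψ.toLinearMap m) = f (e m) := by
  let b := Module.Basis.ofVectorSpace k V
  refine ⟨(Algebra.TensorProduct.basis R b).constr R fun i =>
    f (e (Algebra.TensorProduct.basis B b i)), fun m => ?_⟩
  induction m using MinimalResolution.induction_on_basis (Algebra.TensorProduct.basis B b) with
  | zero => simp
  | add m n hm hn => simp only [map_add, hm, hn]
  | smul c i =>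
    have : LinearMap.rTensor V ψ.toLinearMap (Algebra.TensorProduct.basis B b i) =
        Algebra.TensorProduct.basis R b i := by
      simp
    rw [rTensor_algHom_smul, this, map_smul, Module.Basis.constr_basis, map_smul, hf]

/-- The base change of an endomorphism of `V_B` along `ψ`. -/
noncomputable def extendEnd (e : Module.End B (B ⊗[k] V)) : Module.End R (R ⊗[k] V) :=
  (exists_extension ψ e (LinearMap.rTensor V ψ.toLinearMap).toAddMonoidHom
    (rTensor_algHom_smul ψ)).choose

lemma extendEnd_rTensor (e : Module.End B (B ⊗[k] V)) (m : B ⊗[k] V) :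
    extendEnd ψ e (LinearMap.rTensor V ψ.toLinearMap m) =
      LinearMap.rTensor V ψ.toLinearMap (e m) :=
  (exists_extension ψ e (LinearMap.rTensor V ψ.toLinearMap).toAddMonoidHom
    (rTensor_algHom_smul ψ)).choose_spec m

lemma linearMap_ext_rTensor {N : Type*} [AddCommGroup N] [Module R N] {f g : R ⊗[k] V →ₗ[R] N}
    (h : ∀ m : B ⊗[k] V, f (LinearMap.rTensor V ψ.toLinearMap m) =
      g (LinearMap.rTensor V ψ.toLinearMap m)) : f = g :=
  LinearMap.ext_on_range (span_range_rTensor ψ) h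

lemma isIdempotentElem_extendEnd {e : Module.End B (B ⊗[k] V)} (he : IsIdempotentElem e) :
    IsIdempotentElem (extendEnd ψ e) :=
  linearMap_ext_rTensor ψ fun m => by
    rw [Module.End.mul_apply, extendEnd_rTensor, extendEnd_rTensor, ← Module.End.mul_apply, he]

lemma grassmannMap_range (e : Module.End B (B ⊗[k] V)) :
    grassmannMap ψ (LinearMap.range e) = LinearMap.range (extendEnd ψ e) := by
  rw [← Submodule.map_top (extendEnd ψ e), ← span_range_rTensor ψ, Submodule.map_span, grassmannMap]
  congr 1
  ext x
  simp only [Set.mem_image, Set.mem_range, SetLike.mem_coe, LinearMap.mem_range]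
  constructor
  · rintro ⟨_, ⟨m, rfl⟩, rfl⟩
    exact ⟨_, ⟨m, rfl⟩, extendEnd_rTensor ψ e m⟩
  · rintro ⟨_, ⟨m, rfl⟩, rfl⟩
    exact ⟨_, ⟨m, rfl⟩, (extendEnd_rTensor ψ e m).symm⟩

lemma exists_idempotent_of_mem_grassmannPoints {d : ℕ} {W : Submodule B (B ⊗[k] V)}
    (hW : W ∈ grassmannPoints k V d B) :
    ∃ e : Module.End B (B ⊗[k] V), IsIdempotentElem e ∧ LinearMap.range e = W := by
  obtain ⟨⟨W', h⟩, -⟩ := hW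
  exact ⟨W.projection W' h, Submodule.isIdempotentElem_projection h, Submodule.range_projection h⟩

lemma grassmannMap_mem_grassmannPoints [Module.Finite k V] {d : ℕ} {W : Submodule B (B ⊗[k] V)}
    (hW : W ∈ grassmannPoints k V d B) : grassmannMap ψ W ∈ grassmannPoints k V d R := by
  obtain ⟨e, he, rfl⟩ := exists_idempotent_of_mem_grassmannPoints hW
  rw [grassmannMap_range]
  refine ⟨⟨_, LinearMap.IsIdempotentElem.isCompl (isIdempotentElem_extendEnd ψ he)⟩, fun 𝔭 => ?_⟩
  let : Algebra B R := ψ.toRingHom.toAlgebra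
  have hsmul : ∀ (b : B) (m : R ⊗[k] V), b • m = ψ b • m := fun b m => (algebraMap_smul R b m).symm
  let θ : LinearMap.range e →ₗ[B] R ⊗[k] V :=
    { toFun w := LinearMap.rTensor V ψ.toLinearMap w.1
      map_add' _ _ := map_add _ _ _
      map_smul' b w := (rTensor_algHom_smul ψ b w.1).trans (hsmul _ _).symm }
  -- The natural map `R ⊗ W → V_R` is injective, and its image is the base change of `W`.
  let Φ : R ⊗[B] LinearMap.range e →ₗ[R] R ⊗[k] V := LinearMap.liftBaseChange R θ
  obtain ⟨Ψ, hΨ⟩ := exists_extension ψ e.rangeRestrict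
    (TensorProduct.mk B R (LinearMap.range e) 1).toAddMonoidHom fun b n => by
      change (1 : R) ⊗ₜ[B] (b • n) = ψ b • ((1 : R) ⊗ₜ[B] n)
      rw [← TensorProduct.smul_tmul, TensorProduct.smul_tmul', Algebra.smul_def, smul_eq_mul]
      rfl
  have hΦ : Function.Injective Φ := by
    refine Function.LeftInverse.injective (g := Ψ) fun x => ?_
    have : Ψ ∘ₗ Φ = LinearMap.id := by
      ext w
      have hw : e.rangeRestrict w.1 = w := Subtype.ext (by
        obtain ⟨m, hm⟩ := w.2
        rw [LinearMap.codRestrict_apply, ← hm, ← Module.End.mul_apply, he])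
      have := hΨ w.1
      rw [hw] at this
      simpa [Φ, θ] using this
    exact LinearMap.congr_fun this x
  have hrange : LinearMap.range Φ = LinearMap.range (extendEnd ψ e) := by
    rw [← grassmannMap_range, grassmannMap]
    apply le_antisymm
    · rintro _ ⟨x, rfl⟩
      induction x using TensorProduct.induction_on with
      | zero => rw [map_zero]; exact Submodule.zero_mem _
      | add x y hx hy => rw [map_add]; exact Submodule.add_mem _ hx hy
      | tmul r w =>
        simp only [Φ, LinearMap.liftBaseChange_tmul]
        exact Submodule.smul_mem _ _ (Submodule.subset_span ⟨w.1, w.2, rfl⟩)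
    · rw [Submodule.span_le]
      rintro _ ⟨w, hw, rfl⟩
      exact ⟨1 ⊗ₜ ⟨w, hw⟩, by simp [Φ, θ]⟩
  have hproj : Module.Projective B (LinearMap.range e) :=
    Module.Projective.of_split (LinearMap.range e).subtype e.rangeRestrict (by
      ext w
      obtain ⟨m, hm⟩ := w.2
      simp only [LinearMap.comp_apply, Submodule.subtype_apply, LinearMap.codRestrict_apply,
        LinearMap.id_apply]
      rw [← hm, ← Module.End.mul_apply, he])
  rw [Module.rankAtStalk_eq_of_equiv
      ((LinearEquiv.ofInjective Φ hΦ).trans (LinearEquiv.ofEq _ _ hrange)).symm]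
  exact (Module.rankAtStalk_baseChange (R := B) (M := LinearMap.range e) 𝔭).trans (hW.2 _)

end BaseChange

section Sub

variable {k : Type u} [Field k] {V : Type u} [AddCommGroup V] [Module k V]
variable {B R : Type v} [CommRing B] [Algebra k B] [CommRing R] [Algebra k R] (ψ : B →ₐ[k] R)

lemma basis_repr_rTensor {ι : Type*} {V : Type u} [AddCommMonoid V] [Module k V]
    (b : Module.Basis ι k V) (m : B ⊗[k] V) (i : ι) :
    (Algebra.TensorProduct.basis R b).repr (LinearMap.rTensor V ψ.toLinearMap m) i =
      ψ ((Algebra.TensorProduct.basis B b).repr m i) := by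
  induction m using TensorProduct.induction_on with
  | zero => simp
  | add m n hm hn => simp only [map_add, Finsupp.add_apply, hm, hn]
  | tmul c v => simp [Algebra.TensorProduct.basis_repr_tmul]

lemma rTensor_eq_zero_iff {ι : Type*} {V : Type u} [AddCommMonoid V] [Module k V]
    (b : Module.Basis ι k V) (m : B ⊗[k] V) :
    LinearMap.rTensor V ψ.toLinearMap m = 0 ↔
      ∀ i, ψ ((Algebra.TensorProduct.basis B b).repr m i) = 0 := by
  rw [← (Algebra.TensorProduct.basis R b).repr.map_eq_zero_iff, Finsupp.ext_iff]
  simp only [basis_repr_rTensor, Finsupp.coe_zero, Pi.zero_apply]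

lemma rTensor_distribBaseChange_symm (m n : B ⊗[k] V) :
    LinearMap.rTensor (V ⊗[k] V) ψ.toLinearMap
        ((AlgebraTensorModule.distribBaseChange k B V V).symm (m ⊗ₜ n)) =
      (AlgebraTensorModule.distribBaseChange k R V V).symm
        (LinearMap.rTensor V ψ.toLinearMap m ⊗ₜ LinearMap.rTensor V ψ.toLinearMap n) := by
  induction m using TensorProduct.induction_on with
  | zero => simp
  | add m m' hm hm' => simp only [TensorProduct.add_tmul, map_add, hm, hm']
  | tmul b v =>
    induction n using TensorProduct.induction_on with
    | zero => simp
    | add n n' hn hn' => simp only [TensorProduct.tmul_add, map_add, hn, hn']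
    | tmul c w => simp

/-- The endomorphism `e ⊗ e` of `V_B ⊗ V_B`, transported to `(V ⊗ V)_B`. -/
noncomputable def tensorSquare (e : Module.End B (B ⊗[k] V)) : Module.End B (B ⊗[k] (V ⊗[k] V)) :=
  (AlgebraTensorModule.distribBaseChange k B V V).symm.toLinearMap ∘ₗ TensorProduct.map e e ∘ₗ
    (AlgebraTensorModule.distribBaseChange k B V V).toLinearMap

lemma tensorSquare_extendEnd (e : Module.End B (B ⊗[k] V)) (m : B ⊗[k] (V ⊗[k] V)) :
    tensorSquare (extendEnd ψ e) (LinearMap.rTensor (V ⊗[k] V) ψ.toLinearMap m) =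
      LinearMap.rTensor (V ⊗[k] V) ψ.toLinearMap (tensorSquare e m) := by
  obtain ⟨m, rfl⟩ := (AlgebraTensorModule.distribBaseChange k B V V).symm.surjective m
  induction m using TensorProduct.induction_on with
  | zero => simp
  | add m n hm hn => simp only [map_add, hm, hn]
  | tmul m n =>
    rw [rTensor_distribBaseChange_symm]
    simp [tensorSquare, rTensor_distribBaseChange_symm, extendEnd_rTensor]

lemma mem_range_map_subtype_iff {e : Module.End B (B ⊗[k] V)} (he : IsIdempotentElem e)
    (x : B ⊗[k] (V ⊗[k] V)) :
    AlgebraTensorModule.distribBaseChange k B V V x ∈ LinearMap.range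
        (TensorProduct.map (LinearMap.range e).subtype (LinearMap.range e).subtype) ↔
      tensorSquare e x = x := by
  have h1 : LinearMap.range
      (TensorProduct.map (LinearMap.range e).subtype (LinearMap.range e).subtype) =
      LinearMap.range (TensorProduct.map e e) := by
    conv_rhs => rw [← LinearMap.subtype_comp_codRestrict e (LinearMap.range e)
      (fun c => LinearMap.mem_range_self e c), TensorProduct.map_comp]
    rw [LinearMap.range_comp_of_range_eq_top]
    rw [LinearMap.range_eq_top]
    exact TensorProduct.map_surjective (LinearMap.surjective_rangeRestrict e)
      (LinearMap.surjective_rangeRestrict e)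
  have h2 : IsIdempotentElem (TensorProduct.map e e) := by
    rw [IsIdempotentElem, ← TensorProduct.map_mul, he]
  rw [h1, LinearMap.IsIdempotentElem.mem_range_iff h2, tensorSquare, LinearMap.comp_apply,
    LinearMap.comp_apply, LinearEquiv.coe_coe, LinearEquiv.coe_coe, LinearEquiv.symm_apply_eq]

end Sub

section SubPoints

variable {k A : Type u} [Field k] [CommRing A] [HopfAlgebra k A]
variable {B R : Type v} [CommRing B] [Algebra k B] [CommRing R] [Algebra k R] (ψ : B →ₐ[k] R)

lemma rTensor_mul (x y : B ⊗[k] GroupAlg k A) :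
    LinearMap.rTensor (GroupAlg k A) ψ.toLinearMap (x * y) =
      LinearMap.rTensor (GroupAlg k A) ψ.toLinearMap x *
        LinearMap.rTensor (GroupAlg k A) ψ.toLinearMap y :=
  map_mul (Algebra.TensorProduct.map ψ (AlgHom.id k (GroupAlg k A))) x y

variable [Module.Finite k A]

lemma baseChange_comul_rTensor (x : B ⊗[k] GroupAlg k A) :
    (GroupAlg.comul k A).baseChange R (LinearMap.rTensor (GroupAlg k A) ψ.toLinearMap x) =
      LinearMap.rTensor _ ψ.toLinearMap ((GroupAlg.comul k A).baseChange B x) := by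
  induction x using TensorProduct.induction_on with
  | zero => simp
  | add x y hx hy => simp only [map_add, hx, hy]
  | tmul b v => simp

/-- The base change of `range e` along `ψ` is a point of `Sub_d` if and only if `ψ` kills the
coordinates of the vectors that measure the failure of `range e` to be closed under multiplication
and comultiplication. -/
lemma grassmannMap_mem_subPoints_iff {d : ℕ} {e : Module.End B (B ⊗[k] GroupAlg k A)}
    (he : IsIdempotentElem e) (hW : LinearMap.range e ∈ grassmannPoints k (GroupAlg k A) d B) :
    grassmannMap ψ (LinearMap.range e) ∈ subPoints k A d R ↔
      (∀ x y, LinearMap.rTensor _ ψ.toLinearMap (e (e x * e y) - e x * e y) = 0) ∧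
      ∀ x, LinearMap.rTensor _ ψ.toLinearMap (tensorSquare e
        ((GroupAlg.comul k A).baseChange B (e x)) - (GroupAlg.comul k A).baseChange B (e x)) = 0 := by
  have hG := grassmannMap_mem_grassmannPoints ψ hW
  have heR := isIdempotentElem_extendEnd ψ he
  rw [subPoints, Set.mem_ofPred_eq, and_iff_right hG, grassmannMap_range]
  refine and_congr ⟨fun h x y => ?_, fun h => ?_⟩ ⟨fun h x => ?_, fun h => ?_⟩
  · have := h _ ⟨LinearMap.rTensor _ ψ.toLinearMap x, rfl⟩ _ ⟨LinearMap.rTensor _ ψ.toLinearMap y, rfl⟩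
    rw [extendEnd_rTensor, extendEnd_rTensor, ← rTensor_mul,
      LinearMap.IsIdempotentElem.mem_range_iff heR, extendEnd_rTensor] at this
    rw [map_sub, this, sub_self]
  · -- Both sides of the identity are bilinear, so it suffices to check it on images of `B ⊗ V`.
    have key : ∀ x y, extendEnd ψ e (extendEnd ψ e x * extendEnd ψ e y) =
        extendEnd ψ e x * extendEnd ψ e y := by
      have : ((LinearMap.mul R (R ⊗[k] GroupAlg k A)).compl₁₂ (extendEnd ψ e)
          (extendEnd ψ e)).compr₂ (extendEnd ψ e) =
          (LinearMap.mul R (R ⊗[k] GroupAlg k A)).compl₁₂ (extendEnd ψ e) (extendEnd ψ e) := by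
        refine linearMap_ext_rTensor ψ fun x => linearMap_ext_rTensor ψ fun y => ?_
        simp only [LinearMap.compr₂_apply, LinearMap.compl₁₂_apply, LinearMap.mul_apply',
          extendEnd_rTensor, ← rTensor_mul]
        rw [← sub_eq_zero, ← map_sub, h]
      exact fun x y => LinearMap.congr_fun (LinearMap.congr_fun this x) y
    rintro _ ⟨x, rfl⟩ _ ⟨y, rfl⟩
    exact ⟨_, key x y⟩
  · have := h _ ⟨LinearMap.rTensor _ ψ.toLinearMap x, rfl⟩
    rw [extendEnd_rTensor, GroupAlg.comulBaseChange, LinearMap.comp_apply, LinearEquiv.coe_coe,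
      baseChange_comul_rTensor, mem_range_map_subtype_iff heR, tensorSquare_extendEnd] at this
    rw [map_sub, this, sub_self]
  · have key : tensorSquare (extendEnd ψ e) ∘ₗ (GroupAlg.comul k A).baseChange R ∘ₗ
        extendEnd ψ e = (GroupAlg.comul k A).baseChange R ∘ₗ extendEnd ψ e := by
      refine linearMap_ext_rTensor ψ fun x => ?_
      simp only [LinearMap.comp_apply, extendEnd_rTensor, baseChange_comul_rTensor,
        tensorSquare_extendEnd]
      rw [← sub_eq_zero, ← map_sub, h]
    rintro _ ⟨x, rfl⟩
    rw [GroupAlg.comulBaseChange, LinearMap.comp_apply, LinearEquiv.coe_coe,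
      mem_range_map_subtype_iff heR]
    exact LinearMap.congr_fun key x

lemma grassmannMap_id {V : Type u} [AddCommGroup V] [Module k V] (W : Submodule B (B ⊗[k] V)) :
    grassmannMap (AlgHom.id k B) W = W := by
  have : LinearMap.rTensor V (AlgHom.id k B).toLinearMap = LinearMap.id := LinearMap.rTensor_id _ _
  rw [grassmannMap, this, LinearMap.id_coe, Set.image_id, Submodule.span_eq]

variable (k A) in
/-- `Sub_d(kG)` is a closed subfunctor of the Grassmann functor. -/
theorem isClosedGrassmannSubfunctor_subPoints (d : ℕ) :
    IsClosedGrassmannSubfunctor.{u, v} (k := k) (V := GroupAlg k A) d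
      (fun R _ _ => subPoints k A d R) := by
  refine ⟨fun R _ _ W hW => hW.1, fun B R _ _ _ _ ψ W hW => ?_, fun B _ _ W hW => ?_⟩
  · obtain ⟨e, he, rfl⟩ := exists_idempotent_of_mem_grassmannPoints hW.1
    have hG := hW.1
    rw [← grassmannMap_id (LinearMap.range e), grassmannMap_mem_subPoints_iff _ he hG] at hW
    rw [grassmannMap_mem_subPoints_iff _ he hG]
    have h : ∀ (V : Type u) [AddCommMonoid V] [Module k V] (m : B ⊗[k] V),
        LinearMap.rTensor V (AlgHom.id k B).toLinearMap m = 0 →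
          LinearMap.rTensor V ψ.toLinearMap m = 0 := by
      intro V _ _ m hm
      have : LinearMap.rTensor V (AlgHom.id k B).toLinearMap = LinearMap.id :=
        LinearMap.rTensor_id _ _
      rw [this, LinearMap.id_apply] at hm
      rw [hm, map_zero]
    exact ⟨fun x y => h _ _ (hW.1 x y), fun x => h _ _ (hW.2 x)⟩
  · obtain ⟨e, he, rfl⟩ := exists_idempotent_of_mem_grassmannPoints hW
    let b := Module.Basis.ofVectorSpace k (GroupAlg k A)
    let c := b.tensorProduct b
    refine ⟨Ideal.span
      ({a | ∃ x y i, (Algebra.TensorProduct.basis B b).repr (e (e x * e y) - e x * e y) i = a} ∪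
      {a | ∃ x i, (Algebra.TensorProduct.basis B c).repr (tensorSquare e
        ((GroupAlg.comul k A).baseChange B (e x)) - (GroupAlg.comul k A).baseChange B (e x)) i = a}),
      fun R _ _ ψ => ?_⟩
    rw [grassmannMap_mem_subPoints_iff ψ he hW]
    simp only [rTensor_eq_zero_iff ψ b, rTensor_eq_zero_iff ψ c]
    change _ ↔ Ideal.span _ ≤ RingHom.ker ψ
    rw [Ideal.span_le, Set.union_subset_iff]
    refine and_congr ⟨?_, fun h x y i => h ⟨x, y, i, rfl⟩⟩ ⟨?_, fun h x i => h ⟨x, i, rfl⟩⟩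
    · rintro h _ ⟨x, y, i, rfl⟩
      exact h x y i
    · rintro h _ ⟨x, i, rfl⟩
      exact h x i

end SubPoints

/-! ### Algebras of height one with enough derivations -/

namespace HeightOne

section Evaluation

variable {k H ι : Type*} [Field k] [CommRing H] [Algebra k H]

lemma aeval_mem_pow {I : Ideal H} {x : ι → H} (hx : ∀ i, x i ∈ I) {f : MvPolynomial ι k} {m : ℕ}
    (hf : f.IsHomogeneous m) : MvPolynomial.aeval x f ∈ I ^ m := by
  rw [MvPolynomial.aeval_def, MvPolynomial.eval₂_eq]
  refine Ideal.sum_mem _ fun s hs => Ideal.mul_mem_left _ _ ?_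
  have h : s.degree = m := by
    by_contra hne
    exact MvPolynomial.mem_support_iff.1 hs (hf.coeff_eq_zero hne)
  rw [← h, Finsupp.degree_apply, ← Finset.prod_pow_eq_pow_sum]
  exact Ideal.prod_mem_prod fun i _ => Ideal.pow_mem_pow (hx i) _

lemma derivation_mem_pow (I : Ideal H) (D : Derivation k H H) (m : ℕ) :
    ∀ y ∈ I ^ (m + 1), D y ∈ I ^ m := by
  induction m with
  | zero => simp
  | succ m ih =>
    intro y hy
    rw [pow_succ'] at hy
    refine Submodule.mul_induction_on hy (fun a ha b hb => ?_) fun a b ha hb => ?_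
    · rw [Derivation.leibniz, smul_eq_mul, smul_eq_mul]
      refine add_mem ?_ (Ideal.mul_mem_right _ _ hb)
      rw [pow_succ']
      exact Ideal.mul_mem_mul ha (ih b hb)
    · rw [map_add]
      exact add_mem ha hb

lemma derivation_aeval [Fintype ι] (x : ι → H) (D : Derivation k H H) (f : MvPolynomial ι k) :
    D (MvPolynomial.aeval x f) = ∑ j, MvPolynomial.aeval x (MvPolynomial.pderiv j f) * D (x j) := by
  induction f using MvPolynomial.induction_on with
  | C a => simp
  | add f g hf hg => simp [hf, hg, add_mul, Finset.sum_add_distrib]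
  | mul_X f i hf =>
    classical
    simp only [map_mul, MvPolynomial.aeval_X, Derivation.leibniz, smul_eq_mul, hf,
      MvPolynomial.pderiv_X, map_add, add_mul, Finset.sum_add_distrib, Finset.mul_sum]
    congr 1
    · rw [Finset.sum_eq_single i]
      · simp
      · intro j _ hj
        simp [hj.symm]
      · simp
    · exact Finset.sum_congr rfl fun j _ => by ring

/-- The polynomials all of whose exponents are less than `p` represent the classes modulo the
`p`-th powers of the variables. -/
lemma exists_restricted (p : ℕ) (f : MvPolynomial ι k) :
    ∃ g : MvPolynomial ι k, (∀ s, g.coeff s ≠ 0 → ∀ i, s i < p) ∧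
      f - g ∈ Ideal.span (Set.range fun i : ι => (MvPolynomial.X i : MvPolynomial ι k) ^ p) := by
  classical
  induction f using MvPolynomial.induction_on' with
  | monomial s a =>
    by_cases hs : ∀ i, s i < p
    · refine ⟨MvPolynomial.monomial s a, fun t ht => ?_, by simp⟩
      rw [MvPolynomial.coeff_monomial] at ht
      have : s = t := by
        by_contra hne
        exact ht (if_neg hne)
      exact this ▸ hs
    · push Not at hs
      obtain ⟨i, hi⟩ := hs
      refine ⟨0, by simp, ?_⟩
      have : MvPolynomial.monomial s a =
          MvPolynomial.monomial (s - Finsupp.single i p) a * MvPolynomial.X i ^ p := by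
        rw [MvPolynomial.X_pow_eq_monomial, MvPolynomial.monomial_mul, mul_one,
          tsub_add_cancel_of_le]
        simpa using hi
      rw [sub_zero, this]
      exact Ideal.mul_mem_left _ _ (Ideal.subset_span ⟨i, rfl⟩)
  | add f g hf hg =>
    obtain ⟨f', hf, hf'⟩ := hf
    obtain ⟨g', hg, hg'⟩ := hg
    refine ⟨f' + g', fun s hs => ?_, by simpa [add_sub_add_comm] using add_mem hf' hg'⟩
    by_cases h : f'.coeff s = 0
    · exact hg s (by simpa [h] using hs)
    · exact hf s h

end Evaluation

section Structure

variable {k H : Type u} {p : ℕ} [Field k] [CharP k p] [CommRing H] [Algebra k H]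

/-- A homogeneous polynomial of degree `m` with exponents less than `p` has no value in `I ^ (m + 1)`
unless it is zero: the derivations `D i` reduce the statement to the partial derivatives. -/
lemma eq_zero_of_aeval_mem_pow {n : ℕ} (ε : H →ₐ[k] k) (x : Fin n → H)
    (hx : ∀ i, ε (x i) = 0) (D : Fin n → Derivation k H H)
    (hD : ∀ i j, ε (D i (x j)) = if i = j then 1 else 0) (m : ℕ) :
    ∀ f : MvPolynomial (Fin n) k, f.IsHomogeneous m → (∀ s, f.coeff s ≠ 0 → ∀ i, s i < p) →
      MvPolynomial.aeval x f ∈ RingHom.ker ε ^ (m + 1) → f = 0 := by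
  have hxI : ∀ i, x i ∈ RingHom.ker ε := hx
  induction m with
  | zero =>
    intro f hf _ h
    obtain ⟨c, rfl⟩ : ∃ c, f = MvPolynomial.C c :=
      ⟨_, MvPolynomial.totalDegree_eq_zero_iff_eq_C.1
        ((MvPolynomial.totalDegree_zero_iff_isHomogeneous _).2 hf)⟩
    have : ε (MvPolynomial.aeval x (MvPolynomial.C c)) = 0 := by simpa using h
    rw [MvPolynomial.aeval_C, AlgHom.commutes] at this
    simp only [Algebra.algebraMap_self, RingHom.id_apply] at this
    rw [this, map_zero]
  | succ m ih =>
    intro f hf hr h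
    have hder : ∀ i, MvPolynomial.pderiv i f = 0 := by
      intro i
      have hhom : ∀ j, (MvPolynomial.pderiv j f).IsHomogeneous m := fun j => hf.pderiv
      refine ih _ (hhom i) (fun s hs j => ?_) ?_
      · rw [MvPolynomial.coeff_pderiv] at hs
        have := hr _ (left_ne_zero_of_mul hs) j
        exact lt_of_le_of_lt (by simp) this
      · have h1 := derivation_mem_pow _ (D i) _ _ h
        rw [derivation_aeval, ← Finset.add_sum_erase _ _ (Finset.mem_univ i)] at h1
        have h2 : ∑ j ∈ Finset.univ.erase i, MvPolynomial.aeval x (MvPolynomial.pderiv j f) *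
            D i (x j) ∈ RingHom.ker ε ^ (m + 1) := by
          refine Ideal.sum_mem _ fun j hj => ?_
          rw [pow_succ]
          refine Ideal.mul_mem_mul (aeval_mem_pow hxI (hhom j)) ?_
          rw [RingHom.mem_ker, hD, if_neg (Finset.ne_of_mem_erase hj).symm]
        have h3 : MvPolynomial.aeval x (MvPolynomial.pderiv i f) * (D i (x i) - 1) ∈
            RingHom.ker ε ^ (m + 1) := by
          rw [pow_succ]
          refine Ideal.mul_mem_mul (aeval_mem_pow hxI (hhom i)) ?_
          rw [RingHom.mem_ker, map_sub, hD, if_pos rfl, map_one, sub_self]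
        have h4 := sub_mem (sub_mem h1 h2) h3
        convert h4 using 1
        ring
    ext s
    rw [MvPolynomial.coeff_zero]
    by_contra hs
    have hdeg : s.degree = m + 1 := by
      by_contra hne
      exact hs (hf.coeff_eq_zero hne)
    obtain ⟨i, hi⟩ : ∃ i, s i ≠ 0 := by
      by_contra! h0
      have : s = 0 := Finsupp.ext h0
      simp [this] at hdeg
    have h5 := congrArg (MvPolynomial.coeff (s - Finsupp.single i 1)) (hder i)
    have hle : Finsupp.single i 1 ≤ s := by simpa using Nat.one_le_iff_ne_zero.2 hi
    rw [MvPolynomial.coeff_pderiv, tsub_add_cancel_of_le hle, MvPolynomial.coeff_zero] at h5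
    have h6 : ((s i : ℕ) : k) = 0 := by
      have := (mul_eq_zero.1 h5).resolve_left hs
      rw [← this]
      norm_cast
      simp only [Finsupp.coe_tsub, Pi.sub_apply, Finsupp.single_eq_same]
      congr 1
      omega
    rw [CharP.cast_eq_zero_iff k p] at h6
    exact absurd (Nat.le_of_dvd (Nat.pos_of_ne_zero hi) h6) (not_le.2 (hr s hs i))

/-- A finite-dimensional augmented commutative algebra in which the `p`-th powers of the elements of
the augmentation ideal `I` vanish is a truncated polynomial ring, if every linear functional on
`I / I²` comes from a derivation of the algebra. -/
theorem nonempty_algEquiv_truncatedPolynomial [Module.Finite k H] (ε : H →ₐ[k] k) (hp : ∀ y, ε y = 0 → y ^ p = 0)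
    (hder : ∀ δ : H →ₗ[k] k, δ 1 = 0 → (∀ y z, ε y = 0 → ε z = 0 → δ (y * z) = 0) →
      ∃ D : Derivation k H H, ∀ y, ε (D y) = δ y) :
    ∃ n, Nonempty (H ≃ₐ[k] TruncatedPolynomial k p n) := by
  have : IsNoetherianRing H := IsNoetherianRing.of_finite k H
  let I : Ideal H := RingHom.ker ε
  have hI : ∀ y, y ∈ I ↔ ε y = 0 := fun y => Iff.rfl
  let I₁ := I.restrictScalars k
  let I₂ : Submodule k I₁ := Submodule.comap I₁.subtype ((I ^ 2).restrictScalars k)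
  let b := Module.finBasis k (I₁ ⧸ I₂)
  -- The projection of `H = k ⊕ I` to `I`.
  let π : H →ₗ[k] I₁ := LinearMap.codRestrict I₁
    (LinearMap.id - (Algebra.linearMap k H) ∘ₗ ε.toLinearMap) fun y => by
      change y - algebraMap k H (ε y) ∈ I
      rw [hI, map_sub, AlgHom.commutes]
      simp
  have hπ : ∀ y : H, (π y : H) = y - algebraMap k H (ε y) := fun y => rfl
  have hπI : ∀ y (hy : y ∈ I), π y = ⟨y, hy⟩ := fun y hy => by
    ext
    rw [hπ, (hI y).1 hy]
    simp
  choose x' hx' using fun i => I₂.mkQ_surjective (b i)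
  let x : Fin (Module.finrank k (I₁ ⧸ I₂)) → H := fun i => x' i
  have hxI : ∀ i, x i ∈ I := fun i => (x' i).2
  let δ : Fin (Module.finrank k (I₁ ⧸ I₂)) → H →ₗ[k] k := fun i => b.coord i ∘ₗ I₂.mkQ ∘ₗ π
  have hδx : ∀ i j, δ i (x j) = if i = j then 1 else 0 := fun i j => by
    have : π (x j) = x' j := hπI _ (hxI j)
    simp only [δ, LinearMap.comp_apply, this, hx', Module.Basis.coord_apply,
      Module.Basis.repr_self, Finsupp.single_apply, eq_comm]
  have hspan : ∀ y ∈ I, y - ∑ i, δ i y • x i ∈ I ^ 2 := by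
    intro y hy
    have h1 : I₂.mkQ (⟨y, hy⟩ - ∑ i, δ i y • x' i) = 0 := by
      rw [map_sub, map_sum, sub_eq_zero]
      conv_lhs => rw [← b.sum_repr (I₂.mkQ ⟨y, hy⟩)]
      refine Finset.sum_congr rfl fun i _ => ?_
      rw [map_smul, hx']
      simp [δ, hπI y hy]
    have h2 := (Submodule.Quotient.mk_eq_zero I₂).1 h1
    simpa [I₂, x] using h2
  choose D hD using fun i => hder (δ i) (by
      have : π 1 = 0 := by
        ext
        rw [hπ]
        simp
      simp [δ, this]) (fun y z hy hz => by
      have h : y * z ∈ I ^ 2 := by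
        rw [pow_two]
        exact Ideal.mul_mem_mul hy hz
      have h1 : I₂.mkQ (π (y * z)) = 0 := by
        rw [hπI _ (Ideal.mul_mem_right _ _ hy)]
        exact (Submodule.Quotient.mk_eq_zero I₂).2 h
      simp only [δ, LinearMap.comp_apply, h1, map_zero])
  have hD' : ∀ i j, ε (D i (x j)) = if i = j then 1 else 0 := fun i j => by rw [hD, hδx]
  refine ⟨_, ⟨(AlgEquiv.ofBijective 
    (TruncatedPolynomial.lift (k := k) x fun i => hp _ (hxI i)) ?_).symm⟩⟩
  have hlift : ∀ f, TruncatedPolynomial.lift (k := k) x (fun i => hp _ (hxI i))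
      (Ideal.Quotient.mk _ f) = MvPolynomial.aeval x f := fun f => rfl
  constructor
  · rw [injective_iff_map_eq_zero]
    intro t ht
    obtain ⟨f, rfl⟩ := Ideal.Quotient.mk_surjective t
    obtain ⟨g, hg, hfg⟩ := exists_restricted p f
    rw [← sub_add_cancel f g, map_add, Ideal.Quotient.eq_zero_iff_mem.2 hfg, zero_add] at ht ⊢
    rw [hlift] at ht
    have hcomp : ∀ m, MvPolynomial.homogeneousComponent m g = 0 := by
      intro m
      induction m using Nat.strong_induction_on with
      | _ m ih =>
        refine eq_zero_of_aeval_mem_pow ε x hxI D hD' m _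
          (MvPolynomial.homogeneousComponent_isHomogeneous m g) (fun s hs => hg s ?_) ?_
        · rw [MvPolynomial.coeff_homogeneousComponent] at hs
          exact fun h => hs (by simp [h])
        · by_cases hm : m ∈ Finset.range (g.totalDegree + 1)
          · rw [← MvPolynomial.sum_homogeneousComponent g, map_sum,
              ← Finset.add_sum_erase _ _ hm] at ht
            rw [eq_neg_of_add_eq_zero_left ht]
            refine neg_mem (Ideal.sum_mem _ fun j hj => ?_)
            rcases lt_trichotomy j m with h | h | h
            · rw [ih j h, map_zero]
              exact zero_mem _
            · exact absurd h (Finset.ne_of_mem_erase hj)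
            · exact Ideal.pow_le_pow_right h
                (aeval_mem_pow hxI (MvPolynomial.homogeneousComponent_isHomogeneous j g))
          · rw [MvPolynomial.homogeneousComponent_eq_zero, map_zero]
            · exact zero_mem _
            · simpa using hm
    rw [← MvPolynomial.sum_homogeneousComponent g, Finset.sum_eq_zero fun m _ => hcomp m, map_zero]
  · have hxr : ∀ i, x i ∈ (MvPolynomial.aeval (R := k) x).range := fun i =>
      ⟨MvPolynomial.X i, by simp⟩
    have hrange : ∀ m, ∀ y ∈ I ^ m, ∃ s ∈ (MvPolynomial.aeval (R := k) x).range, s ∈ I ^ m ∧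
        y - s ∈ I ^ (m + 1) := by
      intro m
      induction m with
      | zero =>
        intro y _
        refine ⟨algebraMap k H (ε y), Subalgebra.algebraMap_mem _ _, by simp, ?_⟩
        rw [zero_add, pow_one, hI, map_sub, AlgHom.commutes]
        simp
      | succ m ih =>
        intro y hy
        rw [pow_succ'] at hy
        refine Submodule.mul_induction_on hy (fun a ha b hb => ?_) ?_
        · obtain ⟨t, ht, htm, hbt⟩ := ih b hb
          have hs : ∑ i, δ i a • x i ∈ I :=
            Submodule.sum_mem I₁ fun i _ => Submodule.smul_mem I₁ _ (hxI i)
          refine ⟨(∑ i, δ i a • x i) * t, mul_mem (sum_mem fun i _ => Subalgebra.smul_mem _ (hxr i) _) ht, ?_, ?_⟩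
          · rw [pow_succ']
            exact Ideal.mul_mem_mul hs htm
          · have h1 := Ideal.mul_mem_mul (hspan a ha) hb
            have h2 := Ideal.mul_mem_mul hs hbt
            rw [← pow_add, show 2 + m = m + 1 + 1 by ring] at h1
            rw [← pow_succ'] at h2
            convert add_mem h1 h2 using 1
            ring
        · rintro a b ⟨s, hs, hs1, hs2⟩ ⟨t, ht, ht1, ht2⟩
          exact ⟨s + t, add_mem hs ht, add_mem hs1 ht1, by
            simpa [add_sub_add_comm] using add_mem hs2 ht2⟩
    obtain ⟨N, hN⟩ : IsNilpotent I :=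
      (Ideal.FG.isNilpotent_iff_le_nilradical (IsNoetherian.noetherian I)).2
        fun y hy => ⟨p, hp y hy⟩
    have hall : ∀ j m, m + j = N → ∀ y ∈ I ^ m, y ∈ (MvPolynomial.aeval (R := k) x).range := by
      intro j
      induction j with
      | zero =>
        rintro m rfl y hy
        rw [add_zero] at hN
        rw [hN] at hy
        rw [(Submodule.mem_bot H).1 hy]
        exact zero_mem _
      | succ j ih =>
        intro m hm y hy
        obtain ⟨s, hs, -, h⟩ := hrange m y hy
        rw [← sub_add_cancel y s]
        exact add_mem (ih (m + 1) (by omega) _ h) hs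
    intro y
    obtain ⟨f, hf⟩ := hall N 0 (zero_add _) y (by simp)
    exact ⟨Ideal.Quotient.mk _ f, hf⟩

end Structure

end HeightOne

/-! ### Group algebras of height one -/

namespace GroupAlg

variable {k C : Type u} [Field k] [CommRing C] [HopfAlgebra k C]

/-- The tensors of two functionals separate the elements of a tensor product. -/
lemma eq_of_forall_map_eq {M : Type*} [AddCommGroup M] [Module k M] [Module.Finite k M]
    {z w : M ⊗[k] M}
    (h : ∀ f g : M →ₗ[k] k, LinearMap.mul' k k (TensorProduct.map f g z) =
      LinearMap.mul' k k (TensorProduct.map f g w)) : z = w := by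
  rw [← sub_eq_zero, ← Module.forall_dual_apply_eq_zero_iff k]
  intro φ
  obtain ⟨t, rfl⟩ := (TensorProduct.dualDistribEquiv k M M).surjective φ
  induction t with
  | zero => simp
  | add s t hs ht => rw [map_add, LinearMap.add_apply, hs, ht, add_zero]
  | tmul f g =>
    have h' : ∀ z, TensorProduct.dualDistribEquiv k M M (f ⊗ₜ g) z =
        LinearMap.mul' k k (TensorProduct.map f g z) := by
      intro z
      induction z with
      | zero => simp
      | add s t hs ht => rw [map_add, map_add, map_add, hs, ht]
      | tmul a b => simp
    rw [map_sub, h', h', h, sub_self]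

lemma mul_apply (f g : GroupAlg k C) (c : C) :
    (f * g).ofConv c =
      LinearMap.mul' k k (TensorProduct.map f.ofConv g.ofConv (Coalgebra.comul (R := k) c)) := rfl

lemma one_apply (c : C) : (1 : GroupAlg k C).ofConv c = Coalgebra.counit (R := k) c := by
  simp

lemma augmentation_apply (f : GroupAlg k C) : augmentation k C f = f.ofConv 1 := rfl

/-- The contragredient action of the coordinate ring on the group algebra: `(a • f) b = f (a b)`. -/
noncomputable def translate (a : C) : GroupAlg k C →ₗ[k] GroupAlg k C :=
  (WithConv.linearEquiv k (C →ₗ[k] k)).symm.toLinearMap ∘ₗ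
    LinearMap.lcomp k k (LinearMap.mulLeft k a) ∘ₗ (WithConv.linearEquiv k (C →ₗ[k] k)).toLinearMap

lemma translate_apply (a b : C) (f : GroupAlg k C) :
    (translate a f).ofConv b = f.ofConv (a * b) := rfl

/-- A functional on the group algebra that vanishes on `1` and on the square of the augmentation
ideal is the evaluation at a primitive element of the coordinate ring. -/
lemma exists_primitive [Module.Finite k C] (δ : GroupAlg k C →ₗ[k] k) (h1 : δ 1 = 0)
    (h2 : ∀ y z, augmentation k C y = 0 → augmentation k C z = 0 → δ (y * z) = 0) :
    ∃ c : C, (∀ f, δ f = f.ofConv c) ∧ Coalgebra.comul (R := k) c = c ⊗ₜ 1 + 1 ⊗ₜ c := by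
  obtain ⟨c, hc⟩ := (Module.evalEquiv k C).surjective
    (δ ∘ₗ (WithConv.linearEquiv k (C →ₗ[k] k)).symm.toLinearMap)
  have hδ : ∀ f, δ f = f.ofConv c := fun f => (LinearMap.congr_fun hc f.ofConv).symm
  refine ⟨c, hδ, eq_of_forall_map_eq fun f g => ?_⟩
  have h := h2 (WithConv.toConv f - f 1 • 1) (WithConv.toConv g - g 1 • 1)
    (by simp [augmentation_apply]) (by simp [augmentation_apply])
  simp only [sub_mul, mul_sub, map_sub, smul_mul_assoc, mul_smul_comm, one_mul, mul_one, map_smul,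
    h1] at h
  rw [hδ, hδ, hδ, mul_apply] at h
  simp only [smul_eq_mul, mul_zero, sub_zero] at h
  rw [map_add, map_add, TensorProduct.map_tmul, TensorProduct.map_tmul, LinearMap.mul'_apply,
    LinearMap.mul'_apply]
  linear_combination h

lemma translate_mul {c : C} (hc : Coalgebra.comul (R := k) c = c ⊗ₜ 1 + 1 ⊗ₜ c)
    (f g : GroupAlg k C) : translate c (f * g) = f * translate c g + translate c f * g := by
  apply WithConv.ofConv_injective
  ext b
  have h : ∀ z : C ⊗[k] C, TensorProduct.map f.ofConv g.ofConv ((c ⊗ₜ 1 + 1 ⊗ₜ c) * z) =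
      TensorProduct.map f.ofConv (translate c g).ofConv z +
        TensorProduct.map (translate c f).ofConv g.ofConv z := by
    intro z
    induction z with
    | zero => simp
    | add s t hs ht =>
      rw [mul_add, map_add, hs, ht, map_add, map_add]
      abel
    | tmul a b => simp [add_mul, translate_apply, add_comm]
  rw [translate_apply, mul_apply, Bialgebra.comul_mul, hc, h, map_add]
  rfl

/-- A commutative group algebra whose augmentation ideal is annihilated by the `p`-th power map is a
truncated polynomial ring: the elements `c` of the coordinate ring with `Δ c = c ⊗ 1 + 1 ⊗ c` act on
the group algebra by derivations. -/
theorem nonempty_algEquiv_truncatedPolynomial [Module.Finite k C] {p : ℕ} [CharP k p]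
    (hcomm : ∀ x y : GroupAlg k C, x * y = y * x)
    (hp : ∀ y : GroupAlg k C, augmentation k C y = 0 → y ^ p = 0) :
    ∃ n, Nonempty (GroupAlg k C ≃ₐ[k] TruncatedPolynomial k p n) := by
  let : CommRing (GroupAlg k C) := { (inferInstance : Ring (GroupAlg k C)) with mul_comm := hcomm }
  refine HeightOne.nonempty_algEquiv_truncatedPolynomial (augmentation k C) hp fun δ h1 h2 => ?_
  obtain ⟨c, hδ, hc⟩ := exists_primitive δ h1 h2
  refine ⟨Derivation.mk' (translate c) fun f g => ?_, fun f => ?_⟩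
  · rw [smul_eq_mul, smul_eq_mul, mul_comm g]
    exact translate_mul hc f g
  · change augmentation k C (translate c f) = δ f
    rw [hδ, augmentation_apply, translate_apply, mul_one]

end GroupAlg

/-! ### Closed subgroup schemes as subspaces of the group algebra -/

/-- An ideal and coideal of a finite-dimensional Hopf algebra is stable under the antipode `S`: for
the projection `π : A → A ⧸ I`, convolution with the identity of `A ⧸ I` is an injective, hence
bijective, endomorphism of `End (A ⧸ I)`, and this provides a map `T` with `T ∘ π = π ∘ S`. -/
lemma Ideal.antipode_mem_of_isCoideal {k A : Type*} [Field k] [CommRing A] [HopfAlgebra k A]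
    [Module.Finite k A] (I : Ideal A) [(I.restrictScalars k).IsCoideal] {x : A} (hx : x ∈ I) :
    HopfAlgebra.antipode k x ∈ I := by
  let π : A →ₐc[k] A ⧸ I := Bialgebra.Quotient.mkBialgHom I
  let Φ : WithConv ((A ⧸ I) →ₗ[k] A ⧸ I) → WithConv (A →ₗ[k] A ⧸ I) := fun φ =>
    WithConv.toConv (φ.ofConv ∘ₗ π.toCoalgHom.toLinearMap)
  have hΦ : Function.Injective Φ := fun φ ψ h => by
    apply WithConv.ofConv_injective
    have hs : Function.Surjective π.toCoalgHom.toLinearMap := Ideal.Quotient.mk_surjective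
    exact (LinearMap.cancel_right hs).1 (WithConv.toConv_injective h)
  have hΦ1 : Φ 1 = 1 := by
    apply WithConv.ofConv_injective
    ext a
    simp [Φ, π]
  have hΦm : ∀ φ ψ, Φ (φ * ψ) = Φ φ * Φ ψ := fun φ ψ => by
    apply WithConv.ofConv_injective
    exact LinearMap.convMul_comp_coalgHom_distrib φ ψ π.toCoalgHom
  let P : WithConv (A →ₗ[k] A ⧸ I) := Φ (WithConv.toConv LinearMap.id)
  let S : WithConv (A →ₗ[k] A ⧸ I) :=
    WithConv.toConv (π.toCoalgHom.toLinearMap ∘ₗ HopfAlgebra.antipode k)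
  have hcomp : ∀ f g : WithConv (A →ₗ[k] A),
      (WithConv.toConv (π.toCoalgHom.toLinearMap ∘ₗ f.ofConv) *
        WithConv.toConv (π.toCoalgHom.toLinearMap ∘ₗ g.ofConv) : WithConv (A →ₗ[k] A ⧸ I)) =
      WithConv.toConv (π.toCoalgHom.toLinearMap ∘ₗ (f * g).ofConv) := fun f g => by
    apply WithConv.ofConv_injective
    exact (LinearMap.algHom_comp_convMul_distrib (Ideal.Quotient.mkₐ k I) f g).symm
  have hone : WithConv.toConv (π.toCoalgHom.toLinearMap ∘ₗ
      (1 : WithConv (A →ₗ[k] A)).ofConv) = 1 := by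
    apply WithConv.ofConv_injective
    ext a
    simp only [LinearMap.comp_apply, LinearMap.convOne_apply]
    rfl
  have hSP : S * P = 1 := by
    rw [← hone, ← LinearMap.antipode_mul_id, ← hcomp]
    rfl
  have hPS : P * S = 1 := by
    rw [← hone, ← LinearMap.id_mul_antipode, ← hcomp]
    rfl
  have : Module.Finite k (WithConv ((A ⧸ I) →ₗ[k] A ⧸ I)) :=
    Module.Finite.equiv (WithConv.linearEquiv k _).symm
  have hinj : Function.Injective
      (LinearMap.mulLeft k (WithConv.toConv (LinearMap.id : (A ⧸ I) →ₗ[k] A ⧸ I))) := by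
    intro φ ψ h
    have h' := congrArg (fun z => S * Φ z) h
    simp only [LinearMap.mulLeft_apply, hΦm] at h'
    rw [← mul_assoc, ← mul_assoc] at h'
    change S * P * _ = S * P * _ at h'
    rw [hSP, one_mul, one_mul] at h'
    exact hΦ h'
  obtain ⟨T, hT⟩ := LinearMap.surjective_of_injective hinj 1
  have hTS : Φ T = S := by
    have h := congrArg (fun z => S * Φ z) hT
    simp only [LinearMap.mulLeft_apply, hΦm, hΦ1, mul_one] at h
    rw [← mul_assoc] at h
    change S * P * _ = S at h
    rwa [hSP, one_mul] at h
  have h := congrArg (fun z : WithConv (A →ₗ[k] A ⧸ I) => z.ofConv x) hTS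
  have hx0 : π.toCoalgHom.toLinearMap x = 0 := Ideal.Quotient.eq_zero_iff_mem.2 hx
  change T.ofConv (π.toCoalgHom.toLinearMap x) = Ideal.Quotient.mk I _ at h
  rw [hx0, map_zero] at h
  exact Ideal.Quotient.eq_zero_iff_mem.1 h.symm

namespace SubgroupScheme

variable {k A : Type u} [Field k] [CommRing A] [HopfAlgebra k A] (E : SubgroupScheme k A)

lemma inclusion_apply (f : E.Alg) (a : A) :
    (E.inclusion f).ofConv a = f.ofConv (Ideal.Quotient.mk E.ideal a) := rfl

lemma inclusion_injective : Function.Injective E.inclusion := by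
  intro f g h
  apply WithConv.ofConv_injective
  refine LinearMap.ext fun a => ?_
  obtain ⟨a, rfl⟩ := Ideal.Quotient.mk_surjective a
  rw [← inclusion_apply, h, inclusion_apply]

lemma inclusion_one : E.inclusion 1 = 1 := by
  apply WithConv.ofConv_injective
  ext a
  rw [inclusion_apply, GroupAlg.one_apply, GroupAlg.one_apply, Bialgebra.Quotient.counit_mk]

lemma inclusion_mul (f g : E.Alg) : E.inclusion (f * g) = E.inclusion f * E.inclusion g := by
  apply WithConv.ofConv_injective
  ext a
  rw [inclusion_apply, GroupAlg.mul_apply, GroupAlg.mul_apply, Bialgebra.Quotient.comul_mk,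
    ← LinearMap.comp_apply (TensorProduct.map _ _), ← TensorProduct.map_comp]
  rfl

lemma inclusion_pow (f : E.Alg) (n : ℕ) : E.inclusion (f ^ n) = E.inclusion f ^ n := by
  induction n with
  | zero => rw [pow_zero, pow_zero, inclusion_one]
  | succ n ih => rw [pow_succ, pow_succ, inclusion_mul, ih]

lemma augmentation_inclusion (f : E.Alg) :
    GroupAlg.augmentation k A (E.inclusion f) = GroupAlg.augmentation k (A ⧸ E.ideal) f := rfl

lemma mem_space {f : GroupAlg k A} : f ∈ E.space ↔ ∀ a ∈ E.ideal, f.ofConv a = 0 := by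
  constructor
  · rintro ⟨f, rfl⟩ a ha
    rw [inclusion_apply, Ideal.Quotient.eq_zero_iff_mem.2 ha, map_zero]
  · intro h
    refine ⟨WithConv.toConv ((E.ideal.restrictScalars k).liftQ f.ofConv h), ?_⟩
    apply WithConv.ofConv_injective
    ext a
    rfl

lemma mem_ideal_iff {a : A} : a ∈ E.ideal ↔ ∀ f ∈ E.space, f.ofConv a = 0 := by
  refine ⟨fun ha f hf => E.mem_space.1 hf a ha, fun h => ?_⟩
  rw [← Ideal.Quotient.eq_zero_iff_mem, ← Module.forall_dual_apply_eq_zero_iff k]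
  exact fun φ => h _ ⟨WithConv.toConv φ, rfl⟩

lemma space_injective : Function.Injective (space : SubgroupScheme k A → _) := by
  intro E F h
  ext a
  rw [E.mem_ideal_iff, F.mem_ideal_iff, h]

lemma finrank_space : Module.finrank k E.space = Module.finrank k E.Alg :=
  LinearMap.finrank_range_of_inj E.inclusion_injective

/-- A subspace of the group algebra that contains `1` and is stable under the multiplication and
under the action of the coordinate ring is the group algebra of a closed subgroup scheme. -/
lemma exists_space_eq [Module.Finite k A] (W : Submodule k (GroupAlg k A)) (h1 : 1 ∈ W)
    (hm : ∀ f ∈ W, ∀ g ∈ W, f * g ∈ W) (ht : ∀ a, ∀ f ∈ W, GroupAlg.translate a f ∈ W) :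
    ∃ E : SubgroupScheme k A, E.space = W := by
  let I : Ideal A :=
    { carrier := {a | ∀ f ∈ W, f.ofConv a = 0}
      add_mem' := fun ha hb f hf => by rw [map_add, ha f hf, hb f hf, add_zero]
      zero_mem' := fun f _ => map_zero _
      smul_mem' := fun a b hb f hf => hb _ (ht a f hf) }
  -- In finite dimension the annihilator of the annihilator of `W` is `W`.
  have hann : ∀ f : GroupAlg k A, (∀ a ∈ I, f.ofConv a = 0) → f ∈ W := by
    intro f hf
    let W' : Submodule k (Module.Dual k A) :=
      W.map (WithConv.linearEquiv k (A →ₗ[k] k)).toLinearMap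
    have h : f.ofConv ∈ W'.dualCoannihilator.dualAnnihilator := by
      rw [Submodule.mem_dualAnnihilator]
      intro a ha
      rw [Submodule.mem_dualCoannihilator] at ha
      exact hf a fun g hg => ha _ ⟨g, hg, rfl⟩
    rw [Subspace.dualCoannihilator_dualAnnihilator_eq] at h
    obtain ⟨g, hg, hgf⟩ := h
    rwa [← WithConv.ofConv_injective hgf]
  have hfun : ∀ φ : (A ⧸ I.restrictScalars k) →ₗ[k] k,
      WithConv.toConv (φ ∘ₗ (I.restrictScalars k).mkQ) ∈ W := fun φ => hann _ fun a ha => by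
    change φ ((I.restrictScalars k).mkQ a) = 0
    rw [Submodule.mkQ_apply, (Submodule.Quotient.mk_eq_zero (I.restrictScalars k)).2 ha,
      map_zero]
  have hco : (I.restrictScalars k).IsCoideal := by
    refine ⟨fun a ha => ?_, fun a ha => ?_⟩
    · rw [← GroupAlg.one_apply]
      exact ha 1 h1
    · refine GroupAlg.eq_of_forall_map_eq (k := k) (M := A ⧸ I.restrictScalars k) fun φ ψ => ?_
      have h := ha _ (hm _ (hfun φ) _ (hfun ψ))
      rw [GroupAlg.mul_apply] at h
      rw [map_zero, map_zero, ← h, WithConv.ofConv_toConv, WithConv.ofConv_toConv,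
        TensorProduct.map_comp]
      rfl
  refine ⟨⟨I, { hco with antipode_mem := fun a ha => I.antipode_mem_of_isCoideal ha }⟩, ?_⟩
  ext f
  rw [mem_space]
  exact ⟨hann f, fun hf a ha => ha f hf⟩

section ElementaryAbelian

variable {p : ℕ} [Fact p.Prime]

lemma finrank_space_of_algEquiv {n : ℕ} (e : E.Alg ≃ₐ[k] TruncatedPolynomial k p n) :
    Module.finrank k E.space = p ^ n := by
  rw [finrank_space, e.toLinearEquiv.finrank_eq]
  exact (TruncatedPolynomial.finite_and_finrank_eq (Fact.out : p.Prime).ne_zero n).2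

variable [CharP k p]

lemma isElementaryAbelian_iff [Module.Finite k A] : E.IsElementaryAbelian p ↔
    (∀ f ∈ E.space, ∀ g ∈ E.space, f * g = g * f) ∧
      ∀ f ∈ E.space, (f - GroupAlg.augmentation k A f • 1) ^ p = 0 := by
  constructor
  · rintro ⟨n, ⟨e⟩⟩
    constructor
    · rintro _ ⟨f, rfl⟩ _ ⟨g, rfl⟩
      rw [← inclusion_mul, ← inclusion_mul]
      congr 1
      apply e.injective
      rw [map_mul, map_mul, mul_comm]
    · rintro _ ⟨f, rfl⟩
      rw [augmentation_inclusion, ← inclusion_one, ← map_smul, ← map_sub, ← inclusion_pow,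
        ← map_zero E.inclusion]
      congr 1
      apply e.injective
      rw [map_pow, TruncatedPolynomial.pow_char
        ((GroupAlg.augmentation k (A ⧸ E.ideal)).comp e.symm.toAlgHom)]
      simp [(Fact.out : p.Prime).ne_zero]
  · rintro ⟨hc, hp⟩
    refine GroupAlg.nonempty_algEquiv_truncatedPolynomial (fun f g => ?_) fun f hf => ?_
    · apply E.inclusion_injective
      rw [inclusion_mul, inclusion_mul, hc _ ⟨f, rfl⟩ _ ⟨g, rfl⟩]
    · have h := hp _ ⟨f, rfl⟩
      rw [augmentation_inclusion, hf, zero_smul, sub_zero, ← inclusion_pow] at h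
      exact E.inclusion_injective (h.trans (map_zero _).symm)

lemma complexity_eq_of_algEquiv {n : ℕ} (e : E.Alg ≃ₐ[k] TruncatedPolynomial k p n) :
    E.complexity = n := by
  let : CommRing E.Alg := { (inferInstance : Ring E.Alg) with
    mul_comm := fun x y => e.injective (by rw [map_mul, map_mul, mul_comm]) }
  exact moduleComplexity_residueModule e.symm (GroupAlg.augmentation k (A ⧸ E.ideal))

lemma mem_elementaryAbelianOfComplexity_iff {ℓ : ℕ} :
    E ∈ elementaryAbelianOfComplexity k A p ℓ ↔
      E.IsElementaryAbelian p ∧ Module.finrank k E.space = p ^ ℓ := by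
  refine and_congr_right ?_
  rintro ⟨n, ⟨e⟩⟩
  rw [E.complexity_eq_of_algEquiv e, E.finrank_space_of_algEquiv e,
    Nat.pow_right_inj (Fact.out : p.Prime).two_le]
  exact Nat.cast_inj

/-- The group algebras of the elementary abelian subgroup schemes among the subspaces of dimension
`p ^ ℓ` of the group algebra. -/
theorem exists_elementaryAbelian_space_eq_iff [Module.Finite k A] {ℓ : ℕ}
    {W : Submodule k (GroupAlg k A)} (hW : Module.finrank k W = p ^ ℓ) :
    (∃ E ∈ elementaryAbelianOfComplexity k A p ℓ, E.space = W) ↔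
      1 ∈ W ∧ (∀ f ∈ W, ∀ g ∈ W, f * g ∈ W) ∧ (∀ a, ∀ f ∈ W, GroupAlg.translate a f ∈ W) ∧
        (∀ f ∈ W, ∀ g ∈ W, f * g = g * f) ∧
        ∀ f ∈ W, (f - GroupAlg.augmentation k A f • 1) ^ p = 0 := by
  constructor
  · rintro ⟨E, hE, rfl⟩
    refine ⟨⟨1, E.inclusion_one⟩, ?_, fun a f hf => ?_, E.isElementaryAbelian_iff.1 hE.1⟩
    · rintro _ ⟨f, rfl⟩ _ ⟨g, rfl⟩
      exact ⟨f * g, E.inclusion_mul f g⟩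
    · rw [mem_space] at hf ⊢
      exact fun b hb => hf _ (Ideal.mul_mem_left _ _ hb)
  · rintro ⟨h1, hm, ht, h⟩
    obtain ⟨E, rfl⟩ := exists_space_eq W h1 hm ht
    exact ⟨E, E.mem_elementaryAbelianOfComplexity_iff.2 ⟨E.isElementaryAbelian_iff.2 h, hW⟩, rfl⟩

end ElementaryAbelian

end SubgroupScheme

/-! ### Homogeneous polynomial maps -/

/-- A map between vector spaces is a homogeneous polynomial map of degree `n` if its composition
with every functional is given by a homogeneous polynomial of degree `n` in the linear forms. -/
def IsHomogeneousMap (k : Type*) [Field k] {U M : Type*} [AddCommGroup U] [Module k U]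
    [AddCommGroup M] [Module k M] (n : ℕ) (g : U → M) : Prop :=
  ∀ ψ : Module.Dual k M, ∃ F : MvPolynomial (Module.Dual k U) k, F.IsHomogeneous n ∧
    ∀ x, ψ (g x) = MvPolynomial.eval (fun φ : Module.Dual k U => φ x) F

namespace IsHomogeneousMap

variable {k U M N P : Type*} [Field k] [AddCommGroup U] [Module k U] [AddCommGroup M] [Module k M]
  [AddCommGroup N] [Module k N] [AddCommGroup P] [Module k P] {m n : ℕ}

lemma const (c : M) : IsHomogeneousMap k 0 (fun _ : U => c) := fun ψ =>
  ⟨MvPolynomial.C (ψ c), MvPolynomial.isHomogeneous_C _ _, fun x => by simp⟩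

lemma linear (L : U →ₗ[k] M) : IsHomogeneousMap k 1 L := fun ψ =>
  ⟨MvPolynomial.X (ψ ∘ₗ L), MvPolynomial.isHomogeneous_X _ _, fun x => by simp⟩

lemma map (L : M →ₗ[k] N) {g : U → M} (hg : IsHomogeneousMap k n g) :
    IsHomogeneousMap k n (fun x => L (g x)) := fun ψ => hg (ψ ∘ₗ L)

lemma sub {g h : U → M} (hg : IsHomogeneousMap k n g) (hh : IsHomogeneousMap k n h) :
    IsHomogeneousMap k n (fun x => g x - h x) := fun ψ => by
  obtain ⟨F, hF, hF'⟩ := hg ψ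
  obtain ⟨G, hG, hG'⟩ := hh ψ
  exact ⟨F - G, hF.sub hG, fun x => by rw [map_sub, map_sub, hF', hG']⟩

lemma bilinear [Module.Finite k M] [Module.Finite k N] (B : M →ₗ[k] N →ₗ[k] P) {g : U → M}
    {h : U → N} (hg : IsHomogeneousMap k m g) (hh : IsHomogeneousMap k n h) :
    IsHomogeneousMap k (m + n) (fun x => B (g x) (h x)) := fun ψ => by
  let b := Module.finBasis k M
  let c := Module.finBasis k N
  choose F hF hF' using fun i => hg (b.coord i)
  choose G hG hG' using fun j => hh (c.coord j)
  refine ⟨∑ i, ∑ j, MvPolynomial.C (ψ (B (b i) (c j))) * (F i * G j), ?_, fun x => ?_⟩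
  · refine MvPolynomial.IsHomogeneous.sum _ _ _ fun i _ =>
      MvPolynomial.IsHomogeneous.sum _ _ _ fun j _ => ?_
    rw [← zero_add (m + n)]
    exact (MvPolynomial.isHomogeneous_C _ _).mul ((hF i).mul (hG j))
  · change ψ (B (g x) (h x)) = _
    conv_lhs => rw [← b.sum_repr (g x), ← c.sum_repr (h x)]
    simp only [map_sum, LinearMap.sum_apply, map_smul, LinearMap.smul_apply, smul_eq_mul, map_mul,
      MvPolynomial.eval_C, ← hF', ← hG', Module.Basis.coord_apply]
    rw [Finset.sum_comm]
    refine Finset.sum_congr rfl fun j _ => ?_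
    rw [Finset.mul_sum]
    refine Finset.sum_congr rfl fun i _ => ?_
    ring

lemma pow {R : Type*} [Ring R] [Algebra k R] [Module.Finite k R] {g : U → R}
    (hg : IsHomogeneousMap k n g) (j : ℕ) : IsHomogeneousMap k (j * n) (fun x => g x ^ j) := by
  induction j with
  | zero =>
    rw [zero_mul]
    simpa only [pow_zero] using const (1 : R)
  | succ j ih =>
    rw [Nat.succ_mul]
    simp only [pow_succ]
    exact ih.bilinear (LinearMap.mul k R) hg

end IsHomogeneousMap

section ProjectiveClosed

variable {k V : Type u} [Field k] [AddCommGroup V] [Module k V]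

lemma isProjectiveClosed_iInter {ι : Sort*} {Z : ι → Set (ℙ k V)}
    (hZ : ∀ i, IsProjectiveClosed k V (Z i)) : IsProjectiveClosed k V (⋂ i, Z i) := by
  choose S hS hZ using hZ
  refine ⟨⋃ i, S i, fun F hF => ?_, ?_⟩
  · obtain ⟨i, hi⟩ := Set.mem_iUnion.1 hF
    exact hS i F hi
  · ext x
    simp only [Set.mem_iInter, hZ, Set.mem_ofPred_eq, Set.mem_iUnion]
    exact ⟨fun h F ⟨i, hi⟩ => h i F hi, fun h i F hi => h F ⟨i, hi⟩⟩

lemma isProjectiveClosed_inter {Y Z : Set (ℙ k V)} (hY : IsProjectiveClosed k V Y)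
    (hZ : IsProjectiveClosed k V Z) : IsProjectiveClosed k V (Y ∩ Z) := by
  rw [Set.inter_eq_iInter]
  exact isProjectiveClosed_iInter fun b => by cases b <;> assumption

lemma isProjectiveClosed_setOf_eq_zero {M : Type*} [AddCommGroup M] [Module k M] {n : ℕ} {g : V → M}
    (hg : IsHomogeneousMap k n g) : IsProjectiveClosed k V {x | g x.rep = 0} := by
  choose F hF hF' using hg
  refine ⟨Set.range F, ?_, ?_⟩
  · rintro _ ⟨ψ, rfl⟩
    exact ⟨n, hF ψ⟩
  · ext x
    simp only [Set.mem_ofPred_eq, Set.forall_mem_range, ← hF']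
    exact (Module.forall_dual_apply_eq_zero_iff k _).symm

end ProjectiveClosed

/-! ### Decomposable elements of the exterior powers -/

section Decomposable

variable {k V : Type*} [Field k] [AddCommGroup V] [Module k V]

lemma contractLeft_mem_exteriorPower (f : Module.Dual k V) (n : ℕ) :
    ∀ ω ∈ ⋀[k]^(n + 1) V, CliffordAlgebra.contractLeft (Q := 0) f ω ∈ ⋀[k]^n V := by
  induction n with
  | zero =>
    intro ω hω
    rw [zero_add, ExteriorAlgebra.exteriorPower, pow_one] at hω
    obtain ⟨v, rfl⟩ := hω
    rw [ExteriorAlgebra.exteriorPower, pow_zero]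
    exact ⟨f v, ((CliffordAlgebra.contractLeft_ι _ f v).trans (Algebra.algebraMap_eq_smul_one _)).symm⟩
  | succ n ih =>
    intro ω hω
    rw [ExteriorAlgebra.exteriorPower, pow_succ'] at hω
    refine Submodule.mul_induction_on hω ?_ fun a b ha hb => ?_
    · rintro _ ⟨v, rfl⟩ η hη
      have h := CliffordAlgebra.contractLeft_ι_mul (Q := (0 : QuadraticForm k V)) f v η
      rw [ExteriorAlgebra.ι, h]
      refine sub_mem (Submodule.smul_mem _ _ hη) ?_
      rw [ExteriorAlgebra.exteriorPower, pow_succ']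
      exact Submodule.mul_mem_mul ⟨v, rfl⟩ (ih η hη)
    · rw [map_add]
      exact add_mem ha hb

/-- The vectors `v` with `v ∧ ω = 0` for a nonzero `ω` of degree `d` span a space of dimension at
most `d`, and in the case of equality `ω` is the product of the vectors of a basis of this space. -/
lemma le_and_exists_eq_smul_ιMulti (d : ℕ) : ∀ (ω : ExteriorAlgebra k V), ω ∈ ⋀[k]^d V → ω ≠ 0 →
    ∀ {m : ℕ} (v : Fin m → V), LinearIndependent k v → (∀ i, ExteriorAlgebra.ι k (v i) * ω = 0) →
      m ≤ d ∧ (m = d → ∃ c : k, ω = c • ExteriorAlgebra.ιMulti k m v) := by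
  induction d with
  | zero =>
    intro ω hω h0 m v hv hvω
    rw [ExteriorAlgebra.exteriorPower, pow_zero] at hω
    obtain ⟨c, rfl⟩ := hω
    rw [LinearMap.toSpanSingleton_apply] at *
    have hc : c ≠ 0 := fun hc => h0 (by rw [hc, zero_smul])
    have hm : m = 0 := by
      by_contra hm
      have h := hvω ⟨0, Nat.pos_of_ne_zero hm⟩
      rw [mul_smul_comm, mul_one, smul_eq_zero_iff_right hc, ExteriorAlgebra.ι_eq_zero_iff] at h
      exact hv.ne_zero _ h
    subst hm
    exact ⟨le_rfl, fun _ => ⟨c, by rw [ExteriorAlgebra.ιMulti_zero_apply]⟩⟩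
  | succ d ih =>
    intro ω hω h0 m v hv hvω
    obtain _ | m := m
    · exact ⟨Nat.zero_le _, fun h => absurd h (Nat.succ_ne_zero d).symm⟩
    · classical
      let b := Module.Basis.extend hv.linearIndepOn_id
      have hmem : ∀ i, v i ∈ hv.linearIndepOn_id.extend (Set.subset_univ _) := fun i =>
        hv.linearIndepOn_id.subset_extend _ ⟨i, rfl⟩
      let f := b.coord ⟨v 0, hmem 0⟩
      have hf : ∀ i, f (v i) = if i = 0 then 1 else 0 := fun i => by
        have h : v i = b ⟨v i, hmem i⟩ := by simp [b]
        rw [h, Module.Basis.coord_apply, Module.Basis.repr_self, Finsupp.single_apply]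
        simp [hv.injective.eq_iff]
      have hcon : ∀ i, f (v i) • ω = ExteriorAlgebra.ι k (v i) *
          CliffordAlgebra.contractLeft (Q := 0) f ω := fun i => by
        have h := CliffordAlgebra.contractLeft_ι_mul (Q := (0 : QuadraticForm k V)) f (v i) ω
        have h' : CliffordAlgebra.ι (0 : QuadraticForm k V) (v i) * ω = 0 := hvω i
        rw [h', map_zero] at h
        exact sub_eq_zero.1 h.symm
      have hω' : ω = ExteriorAlgebra.ι k (v 0) * CliffordAlgebra.contractLeft (Q := 0) f ω := by
        rw [← hcon, hf, if_pos rfl, one_smul]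
      obtain ⟨h1, h2⟩ := ih _ (contractLeft_mem_exteriorPower f d ω hω)
        (fun h => h0 (by rw [hω', h, mul_zero])) (fun i : Fin m => v i.succ)
        (hv.comp _ (Fin.succ_injective m)) fun i => by
          rw [← hcon, hf, if_neg (Fin.succ_ne_zero i), zero_smul]
      refine ⟨Nat.succ_le_succ h1, fun hmd => ?_⟩
      obtain ⟨c, hc⟩ := h2 (Nat.succ_injective hmd)
      refine ⟨c, ?_⟩
      rw [ExteriorAlgebra.ιMulti_succ_apply, ← mul_smul_comm]
      exact hω'.trans (congrArg _ hc)

variable (k V) in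
/-- The linear maps `⋀ᵈ V → V` that map `⋀ᵈ W` to `W` for all subspaces `W` of dimension `d`. -/
def contractions (d : ℕ) : Submodule k (⋀[k]^d V →ₗ[k] V) where
  carrier := {L | ∀ W : Submodule k V, Module.finrank k W = d →
    ∀ ω ∈ LinearMap.range (exteriorPower.map d W.subtype), L ω ∈ W}
  add_mem' hL hL' W hW ω hω := add_mem (hL W hW ω hω) (hL' W hW ω hω)
  zero_mem' W _ _ _ := zero_mem W
  smul_mem' c _ hL W hW ω hω := W.smul_mem c (hL W hW ω hω)

/-- The contraction of `ω` by `d - 1` functionals `f j`, `j ≠ i`: the vector on which a functional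
`g` takes the value of `f 0 ∧ … ∧ g ∧ … ∧ f (d - 1)` at `ω`, with `g` at position `i`. -/
noncomputable def partialContraction [Module.Finite k V] {d : ℕ} (f : Fin d → Module.Dual k V)
    (i : Fin d) : ⋀[k]^d V →ₗ[k] V :=
  (Module.evalEquiv k V).symm.toLinearMap ∘ₗ
    ((exteriorPower.alternatingMapToDual k V d).toMultilinearMap.toLinearMap f i).flip

lemma apply_partialContraction [Module.Finite k V] {d : ℕ} (f : Fin d → Module.Dual k V)
    (i : Fin d) (g : Module.Dual k V) (ω : ⋀[k]^d V) :
    g (partialContraction f i ω) =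
      exteriorPower.alternatingMapToDual k V d (Function.update f i g) ω := by
  simp [partialContraction]

lemma exteriorPower.range_map_subtype_le {d : ℕ} (W : Submodule k V)
    {N : Submodule k (⋀[k]^d V)} (h : ∀ w : Fin d → W, exteriorPower.ιMulti k d (fun i => (w i : V)) ∈ N) :
    LinearMap.range (exteriorPower.map d W.subtype) ≤ N := by
  rw [LinearMap.range_eq_map, ← exteriorPower.ιMulti_span, Submodule.map_span, Submodule.span_le]
  rintro _ ⟨_, ⟨w, rfl⟩, rfl⟩
  rw [exteriorPower.map_apply_ιMulti]
  exact h w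

lemma partialContraction_mem [Module.Finite k V] {d : ℕ} (f : Fin d → Module.Dual k V)
    (i : Fin d) : partialContraction f i ∈ contractions k V d := by
  intro W _ ω hω
  refine (exteriorPower.range_map_subtype_le W (N := W.comap (partialContraction f i))
    fun w => ?_) hω
  suffices h : partialContraction f i (exteriorPower.ιMulti k d fun i => (w i : V)) ∈
      W.dualAnnihilator.dualCoannihilator by
    rwa [Subspace.dualAnnihilator_dualCoannihilator_eq] at h
  rw [Submodule.mem_dualCoannihilator]
  intro g hg
  rw [apply_partialContraction, exteriorPower.alternatingMapToDual_apply_ιMulti]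
  refine Matrix.det_eq_zero_of_column_eq_zero i fun j => ?_
  rw [Matrix.of_apply, Function.update_self]
  exact (Submodule.mem_dualAnnihilator g).1 hg _ (w j).2

lemma exists_alternatingMapToDual_ne_zero [Module.Finite k V] {d : ℕ} {ω : ⋀[k]^d V} (hω : ω ≠ 0) :
    ∃ f : Fin d → Module.Dual k V, exteriorPower.alternatingMapToDual k V d f ω ≠ 0 := by
  by_contra! h
  apply hω
  apply ((Module.finBasis k V).exteriorPower d).repr.injective
  ext s
  rw [exteriorPower.basis_repr_apply, exteriorPower.ιMultiDual, exteriorPower.ιMulti_family,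
    exteriorPower.pairingDual, exteriorPower.alternatingMapLinearEquiv_apply_ιMulti, h]
  simp

lemma le_finrank_map_contractions [Module.Finite k V] {d : ℕ} {ω : ⋀[k]^d V} (hω : ω ≠ 0) :
    d ≤ Module.finrank k ((contractions k V d).map (LinearMap.applyₗ ω)) := by
  obtain ⟨f, hf⟩ := exists_alternatingMapToDual_ne_zero hω
  let w : Fin d → (contractions k V d).map (LinearMap.applyₗ ω) := fun i =>
    ⟨partialContraction f i ω, ⟨_, partialContraction_mem f i, rfl⟩⟩
  have hw : ∀ i j, f j (w i) = if j = i then exteriorPower.alternatingMapToDual k V d f ω else 0 := by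
    intro i j
    change f j (partialContraction f i ω) = _
    rw [apply_partialContraction]
    split_ifs with h
    · rw [h, Function.update_eq_self]
    · rw [AlternatingMap.map_update_self _ _ (Ne.symm h), LinearMap.zero_apply]
  have hli : LinearIndependent k w := by
    rw [Fintype.linearIndependent_iff]
    intro c hc j
    have h := congrArg (fun x => f j (Submodule.subtype _ x)) hc
    simp only [map_sum, map_smul, Submodule.subtype_apply, hw, map_zero, smul_eq_mul] at h
    simpa [hf] using h
  simpa using hli.fintype_card_le_finrank

end Decomposable

section Plucker

variable {k V : Type u} [Field k] [AddCommGroup V] [Module k V] [Module.Finite k V] {d : ℕ}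

/-- The vectors `v` with `v ∧ ω = 0`. -/
noncomputable def wedgeKernel (ω : ⋀[k]^d V) : Submodule k V :=
  LinearMap.ker ((LinearMap.mulRight k (ω : ExteriorAlgebra k V)) ∘ₗ ExteriorAlgebra.ι k)

lemma finrank_wedgeKernel_le {ω : ⋀[k]^d V} (hω : ω ≠ 0) :
    Module.finrank k (wedgeKernel ω) ≤ d :=
  (le_and_exists_eq_smul_ιMulti d ω ω.2 (by simpa using hω)
    (fun i => (Module.finBasis k (wedgeKernel ω) i : V))
    ((Module.finBasis k (wedgeKernel ω)).linearIndependent.map' _ (Submodule.ker_subtype _))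
    fun i => (Module.finBasis k (wedgeKernel ω) i).2).1

lemma mem_range_map_wedgeKernel {ω : ⋀[k]^d V} (hω : ω ≠ 0)
    (h : Module.finrank k (wedgeKernel ω) = d) :
    ω ∈ LinearMap.range (exteriorPower.map d (wedgeKernel ω).subtype) := by
  let b := Module.finBasisOfFinrankEq k (wedgeKernel ω) h
  have h' := le_and_exists_eq_smul_ιMulti d ω ω.2 (by simpa using hω)
    (fun i => (wedgeKernel ω).subtype (b i))
    (b.linearIndependent.map' _ (Submodule.ker_subtype _)) fun i => (b i).2
  obtain ⟨c, hc⟩ := h'.2 rfl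
  refine ⟨c • exteriorPower.ιMulti k d b, ?_⟩
  rw [map_smul, exteriorPower.map_apply_ιMulti]
  exact Subtype.ext hc.symm

lemma rep_plucker_mem (W : GrassmannVariety k V d) :
    (plucker d W).rep ∈ LinearMap.range (exteriorPower.map d W.1.subtype) := by
  have h : (plucker d W).submodule = LinearMap.range (exteriorPower.map d W.1.subtype) :=
    Projectivization.submodule_mk'' _ (finrank_range_exteriorPower_map d W)
  rw [← h, Projectivization.submodule_eq]
  exact Submodule.mem_span_singleton_self _

lemma map_contractions_rep_plucker (W : GrassmannVariety k V d) :
    (contractions k V d).map (LinearMap.applyₗ (plucker d W).rep) = W.1 := by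
  refine Submodule.eq_of_le_of_finrank_le ?_ ?_
  · rintro _ ⟨L, hL, rfl⟩
    exact hL W.1 W.2 _ (rep_plucker_mem W)
  · rw [W.2]
    exact le_finrank_map_contractions (plucker d W).rep_nonzero

lemma wedgeKernel_rep_plucker (W : GrassmannVariety k V d) :
    wedgeKernel (plucker d W).rep = W.1 := by
  symm
  refine Submodule.eq_of_le_of_finrank_le (fun v hv => ?_) ?_
  · let N : Submodule k (⋀[k]^d V) := LinearMap.ker
      (LinearMap.mulLeft k (ExteriorAlgebra.ι k v) ∘ₗ (⋀[k]^d V).subtype)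
    refine exteriorPower.range_map_subtype_le W.1 (N := N) (fun w => ?_) (rep_plucker_mem W)
    have hdep : ¬ LinearIndependent k (Fin.cons ⟨v, hv⟩ w : Fin (d + 1) → W.1) := fun h => by
      have := h.fintype_card_le_finrank
      rw [W.2, Fintype.card_fin] at this
      omega
    have h := ((ExteriorAlgebra.ιMulti k (d + 1)).compLinearMap W.1.subtype).map_linearDependent
      _ hdep
    rw [AlternatingMap.compLinearMap_apply, ExteriorAlgebra.ιMulti_succ_apply] at h
    exact h
  · rw [W.2]
    exact finrank_wedgeKernel_le (plucker d W).rep_nonzero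

/-- The quadratic relations `L ω ∧ ω = 0` characterise the image of the Plücker embedding. -/
lemma mem_range_plucker {x : ℙ k (⋀[k]^d V)}
    (hx : ∀ L ∈ contractions k V d, L x.rep ∈ wedgeKernel x.rep) : x ∈ Set.range (plucker d) := by
  have h : Module.finrank k (wedgeKernel x.rep) = d := by
    refine le_antisymm (finrank_wedgeKernel_le x.rep_nonzero)
      ((le_finrank_map_contractions x.rep_nonzero).trans (Submodule.finrank_mono ?_))
    rintro _ ⟨L, hL, rfl⟩
    exact hx L hL
  refine ⟨⟨wedgeKernel x.rep, h⟩, Projectivization.submodule_injective ?_⟩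
  rw [plucker, Projectivization.submodule_mk'']
  refine (Submodule.eq_of_le_of_finrank_le ?_ ?_).symm
  · rw [Projectivization.submodule_eq, Submodule.span_singleton_le_iff_mem]
    exact mem_range_map_wedgeKernel x.rep_nonzero h
  · rw [Projectivization.finrank_submodule]
    exact (finrank_range_exteriorPower_map d ⟨wedgeKernel x.rep, h⟩).le

lemma isProjectiveClosed_setOf_mem_wedgeKernel {n : ℕ} {g : ⋀[k]^d V → V}
    (hg : IsHomogeneousMap k n g) :
    IsProjectiveClosed k (⋀[k]^d V) {x | g x.rep ∈ wedgeKernel x.rep} := by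
  have h := hg.bilinear ((LinearMap.mul k (ExteriorAlgebra k V)).compl₁₂ (ExteriorAlgebra.ι k)
    (⋀[k]^d V).subtype) (IsHomogeneousMap.linear LinearMap.id)
  exact isProjectiveClosed_setOf_eq_zero h

/-- A set of `d`-dimensional subspaces is closed if its points are characterised by homogeneous
equations for the Plücker coordinates. -/
lemma isProjectiveGrassmannSubvariety_of_iff {Z : Set (GrassmannVariety k V d)}
    {Y : Set (ℙ k (⋀[k]^d V))} (hY : IsProjectiveClosed k (⋀[k]^d V) Y)
    (h : ∀ W, W ∈ Z ↔ plucker d W ∈ Y) : IsProjectiveGrassmannSubvariety d Z := by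
  have hrange : plucker d '' Z = Y ∩ ⋂ L : contractions k V d,
      {x | L.1 x.rep ∈ wedgeKernel x.rep} := by
    ext x
    constructor
    · rintro ⟨W, hW, rfl⟩
      refine ⟨(h W).1 hW, Set.mem_iInter.2 fun L => ?_⟩
      rw [Set.mem_ofPred_eq, wedgeKernel_rep_plucker, ← map_contractions_rep_plucker]
      exact ⟨L.1, L.2, rfl⟩
    · rintro ⟨hx, hx'⟩
      obtain ⟨W, rfl⟩ := mem_range_plucker fun L hL => Set.mem_iInter.1 hx' ⟨L, hL⟩
      exact ⟨W, (h W).2 hx, rfl⟩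
  rw [IsProjectiveGrassmannSubvariety, hrange]
  exact isProjectiveClosed_inter hY (isProjectiveClosed_iInter fun L =>
    isProjectiveClosed_setOf_mem_wedgeKernel (IsHomogeneousMap.linear L.1))

end Plucker

/-! ### The variety of elementary abelian subgroup schemes -/

/-- The subalgebras `W` of dimension `d` with the listed properties form a closed set: for Plücker
coordinates `ω` of `W`, the elements of `W` are the values `L ω` of the contractions `L` and also the
solutions of `v ∧ ω = 0`, so that the conditions on `W` are equations in `ω`. -/
lemma isProjectiveGrassmannSubvariety_subalgebra {k H : Type u} {ι : Type*} [Field k] [Ring H]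
    [Algebra k H] [Module.Finite k H] (ε : H →ₐ[k] k) (T : ι → H →ₗ[k] H) (p d : ℕ) :
    IsProjectiveGrassmannSubvariety d {W : GrassmannVariety k H d |
      1 ∈ W.1 ∧ (∀ f ∈ W.1, ∀ g ∈ W.1, f * g ∈ W.1) ∧ (∀ a, ∀ f ∈ W.1, T a f ∈ W.1) ∧
        (∀ f ∈ W.1, ∀ g ∈ W.1, f * g = g * f) ∧ ∀ f ∈ W.1, (f - ε f • 1) ^ p = 0} := by
  let 𝓛 := contractions k H d
  have hlin : ∀ L : 𝓛, IsHomogeneousMap k 1 L.1 := fun L => IsHomogeneousMap.linear L.1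
  have hmul : ∀ L L' : 𝓛, IsHomogeneousMap k (1 + 1) fun ω => L.1 ω * L'.1 ω := fun L L' =>
    (hlin L).bilinear (LinearMap.mul k H) (hlin L')
  have hpow : ∀ L : 𝓛, IsHomogeneousMap k (p * 1) fun ω => (L.1 ω - ε (L.1 ω) • 1) ^ p := fun L =>
    ((hlin L).sub ((hlin L).map (ε.toLinearMap.smulRight (1 : H)))).pow p
  have h1 := isProjectiveClosed_setOf_mem_wedgeKernel (d := d)
    (IsHomogeneousMap.const (k := k) (1 : H))
  have h2 := isProjectiveClosed_iInter fun L : 𝓛 => isProjectiveClosed_iInter fun L' : 𝓛 =>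
    isProjectiveClosed_setOf_mem_wedgeKernel (hmul L L')
  have h3 := isProjectiveClosed_iInter fun a : ι => isProjectiveClosed_iInter fun L : 𝓛 =>
    isProjectiveClosed_setOf_mem_wedgeKernel ((hlin L).map (T a))
  have h4 := isProjectiveClosed_iInter fun L : 𝓛 => isProjectiveClosed_iInter fun L' : 𝓛 =>
    isProjectiveClosed_setOf_eq_zero ((hmul L L').sub (hmul L' L))
  have h5 := isProjectiveClosed_iInter fun L : 𝓛 => isProjectiveClosed_setOf_eq_zero (hpow L)
  refine isProjectiveGrassmannSubvariety_of_iff (isProjectiveClosed_inter h1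
    (isProjectiveClosed_inter h2 (isProjectiveClosed_inter h3 (isProjectiveClosed_inter h4 h5))))
    fun W => ?_
  have hforall : ∀ {P : H → Prop}, (∀ f ∈ W.1, P f) ↔ ∀ L : 𝓛, P (L.1 (plucker d W).rep) :=
    fun {P} => by
      rw [← map_contractions_rep_plucker W]
      exact ⟨fun h L => h _ ⟨L.1, L.2, rfl⟩, fun h f ⟨L, hL, hf⟩ => hf ▸ h ⟨L, hL⟩⟩
  simp only [Set.mem_inter_iff, Set.mem_iInter, Set.mem_ofPred_eq, wedgeKernel_rep_plucker,
    hforall, sub_eq_zero]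

theorem proposition2p6 {k A : Type u} [Field k] [IsAlgClosed k] (p : ℕ) [Fact p.Prime] [CharP k p]
    [CommRing A] [HopfAlgebra k A] [Module.Finite k A] :
    (∀ d : ℕ, IsClosedGrassmannSubfunctor.{u, v} (k := k) (V := GroupAlg k A) d
      (fun R _ _ => subPoints k A d R)) ∧
    ∀ ℓ : ℕ,
      (∀ E ∈ elementaryAbelianOfComplexity k A p ℓ, Module.finrank k E.space = p ^ ℓ) ∧
      Set.InjOn SubgroupScheme.space (elementaryAbelianOfComplexity k A p ℓ) ∧
      IsProjectiveGrassmannSubvariety (p ^ ℓ)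
        {W : GrassmannVariety k (GroupAlg k A) (p ^ ℓ) |
          ∃ E ∈ elementaryAbelianOfComplexity k A p ℓ, E.space = W.1} := by
  refine ⟨isClosedGrassmannSubfunctor_subPoints k A, fun ℓ =>
    ⟨fun E hE => (E.mem_elementaryAbelianOfComplexity_iff.1 hE).2,
      SubgroupScheme.space_injective.injOn, ?_⟩⟩
  have h := isProjectiveGrassmannSubvariety_subalgebra (GroupAlg.augmentation k A)
    GroupAlg.translate p (p ^ ℓ)
  have hiff := fun W : GrassmannVariety k (GroupAlg k A) (p ^ ℓ) =>
    SubgroupScheme.exists_elementaryAbelian_space_eq_iff W.2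
  rwa [← Set.ext hiff] at h
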